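/- \textbf{Setting.} Let $(I,\le)$ be a directed partial order which has a countable cofinal subset. Let $\mathcal L$ be a many-sorted first-order language (classical logic) that contains sorts $(S_i)_{i\in I}$, a binary relation $\le$ between $S_i$ and $S_j$ for all $i\le j$, and a binary relation $E$ on each $S_i$. ``Definable'' means definable by an $\mathcal L$-formula without parameters. A real-valued function on a product of sorts is \emph{strictly definable} if it takes finitely many values and each of its level sets is definable; strict definability in all models of a theory means that the values and the formulas are the same for all models. An \emph{$I$-graded inverse system of finite sets} is an $\mathcal L$-structure $M$ such that: (1) $E$ is an equivalence relation on each $S_i$, with classes of size at most some $K_i\ge 1$; (2) $\le$ is a partial order across the sorts; if $x\in S_i$, $y\in S_j$ and $x\le y$, then $\ge$ restricted to $[y]\times[x]$ is the graph of a surjection $[y]\to[x]$ of $E$-classes; and for $i\le j$ and every $E$-class $a$ of $S_i$ there is a unique $E$-class $b$ of $S_j$ such that $\le$ restricted to $a\times b$ is the graph of a bijection $a\to b$ (we call $b$ the copy of $a$); (3) if $i\le j$, an $E$-class $a$ of $S_j$ is the copy of a class of $S_i$, and $b\le a$ is an $E$-class of $S_j$, then $b$ is the copy of a class of $S_i$ (for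 classes, $b\le a$ means that $y\le x$ for some $y\in b$, $x\in a$); (4) any two $E$-classes $a,b$ of the same $S_i$ have a unique greatest common lower bound $a\wedge b$ among the classes of $S_i$, and for all $i,j$ there is $k\ge i,j$ such that any $E$-classes $a$ of $S_i$ and $b$ of $S_j$ have a least common upper bound $a\vee b$ among the classes of $S_k$. It is a system of \emph{finite probability spaces} if there are strictly definable functions $\mu_i:S_i\to[0,1]$ such that (5) $\sum_{x\in a}\mu_i(x)=1$ for every $E$-class $a$ of $S_i$, and (6) $\mu_i(x)=\sum_{y\in b,\,y\ge x}\mu_j(y)$ for $i\le j$, $E$-classes $a\le b$ of $S_i$ and $S_j$, and $x\in a$. It is \emph{$2$-regular} if moreover (7) whenever $k\ge i$ is such that all joins $a\vee b$ of $E$-classes $a,b$ of $S_i$ exist in $S_k$, then for all $x\in a$, $y\in b$ such that $x\vee y:=\{w\in a\vee b: w\ge x,\ w\ge y\}$ is non-empty, and $z\in a\wedge b$ with $z\le x$, $z\le y$, one has $\mu_k(x\vee y)=\mu_i(x)\mu_i(y)/\mu_i(z)$ (no condition if $\mu_i(z)=0$). For such a system $N$, $\varprojlim N$ is the space of families $(\omega_a)_a$,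 $a$ ranging over all $E$-classes of all sorts, with $\omega_a\in a$ and $\omega_a\le\omega_b$ whenever $a\le b$; it carries the $\sigma$-algebra generated by the projections to the finite sets $a$. An element $x\in S_i$ is identified with the vector $\mathbb 1_{\{\omega_{[x]}=x\}}$ of the real space $L^2(\varprojlim N)$, and $W[x]$ denotes the span of the elements of all $E$-classes $b<[x]$ of $S_i$. \textbf{Proposition.} Let $M$ be a $2$-regular $I$-graded inverse system of finite probability spaces in which some sort $S_i$ is non-empty. Then for every $i\in I$ there are a classical imaginary sort $C_i=S_i/{\sim_i}$ of $\mathrm{Th}(M)$, with $\sim_i$ a definable equivalence relation, and a definable subset $D_i$ of $C_i$, such that the following hold in every $N\models\mathrm{Th}(M)$ ($N$, with the functions $\mu_i$ given by the same formulas, is again a $2$-regular system). There is a unique probability measure on $\varprojlim N$ which projects to $\mu_i$ on every $E$-class of every $S_i$, and in $L^2(\varprojlim N)$ for this measure: \begin{enumerate} \item $x\sim_i y$ if and only if $P_{W[x]^\perp}x=P_{W[y]^\perp}y$; accordingly the elements of $C_i$, and of $D_i$, are identified with vectors; \item the inner product maps on $C_i\times C_j$ and on $C_i\times S_j$ are strictly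 definable for all $i,j\in I$, with the same values and formulas for all $N$; so the closed spans $V_i$ of $D_i$ are strictly interpretable subspaces of $L^2(\varprojlim N)$; \item $D_i$ is asymptotically free: for all $u\in D_i$ and $\varepsilon>0$ the set $\{v\in D_i: |\langle u,v\rangle|\ge\varepsilon\}$ is compact; \item $V_i$ is the completed orthogonal sum of the finite-dimensional subspaces spanned by those elements of $D_i$ that come from $a$, where $a$ ranges over the $E$-classes of $S_i$; \item $L^2(\varprojlim N)$ is the completed orthogonal sum of the subspaces $(V_i)_{i\in I}$. \end{enumerate} -/

import Mathlib

open MeasureTheory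

universe u v w t

/-! ### Many-sorted classical first-order logic -/

/-- A many-sorted first-order language: sorts, function symbols and relation symbols. The arity of
a symbol is the list of the sorts of its arguments. -/
structure MSLanguage where
  Srt : Type u
  Fun : List Srt → Srt → Type v
  Rel : List Srt → Type v

namespace MSLanguage

/-- `Var Γ s` is the type of positions of the list `Γ` that hold the sort `s`: the variables of
sort `s` in the context `Γ`. -/
inductive Var {S : Type u} : List S → S → Type u
  | zero {s : S} {Γ : List S} : Var (s :: Γ) s
  | succ {s s' : S} {Γ : List S} (p : Var Γ s) : Var (s' :: Γ) s

/-- Terms in the context `Γ`, by sort. -/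
inductive Term (L : MSLanguage.{u, v}) (Γ : List L.Srt) : L.Srt → Type (max u v)
  | var {s : L.Srt} (p : Var Γ s) : Term L Γ s
  | app {l : List L.Srt} {s : L.Srt} (f : L.Fun l s)
      (args : ∀ s' : L.Srt, Var l s' → Term L Γ s') : Term L Γ s

/-- First-order formulas, without parameters, whose free variables are those of the context `Γ`. -/
inductive Formula (L : MSLanguage.{u, v}) : List L.Srt → Type (max u v)
  | falsum {Γ : List L.Srt} : Formula L Γ
  | equal {Γ : List L.Srt} {s : L.Srt} (t₁ t₂ : Term L Γ s) : Formula L Γ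
  | rel {Γ l : List L.Srt} (R : L.Rel l) (args : ∀ s : L.Srt, Var l s → Term L Γ s) : Formula L Γ
  | imp {Γ : List L.Srt} (φ ψ : Formula L Γ) : Formula L Γ
  | all {Γ : List L.Srt} (s : L.Srt) (φ : Formula L (s :: Γ)) : Formula L Γ

/-- Assignments of elements to the variables of a context. -/
def Env {S : Type u} (A : S → Type w) (Γ : List S) : Type (max u w) :=
  ∀ s : S, Var Γ s → A s

/-- The empty assignment. -/
def Env.nil {S : Type u} {A : S → Type w} : Env A [] := fun _ p => nomatch p

/-- The assignment that extends `e` by the value `x` for the new first variable. -/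
def Env.cons {S : Type u} {A : S → Type w} {s : S} {Γ : List S} (x : A s) (e : Env A Γ) :
    Env A (s :: Γ)
  | _, .zero => x
  | _, .succ p => e _ p

/-- The assignment of one element to one variable. -/
abbrev env₁ {S : Type u} {A : S → Type w} {s : S} (x : A s) : Env A [s] := Env.cons x Env.nil

/-- The assignment of two elements to two variables. -/
abbrev env₂ {S : Type u} {A : S → Type w} {s s' : S} (x : A s) (y : A s') : Env A [s, s'] :=
  Env.cons x (env₁ y)

/-- Structures in the language `L`. -/
structure Str (L : MSLanguage.{u, v}) where
  carrier : L.Srt → Type w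
  funMap : ∀ {l : List L.Srt} {s : L.Srt}, L.Fun l s → Env carrier l → carrier s
  relMap : ∀ {l : List L.Srt}, L.Rel l → Env carrier l → Prop

variable {L : MSLanguage.{u, v}}

/-- The value of a term. -/
def Term.eval (N : Str.{u, v, w} L) {Γ : List L.Srt} (e : Env N.carrier Γ) :
    ∀ {s : L.Srt}, Term L Γ s → N.carrier s
  | _, .var p => e _ p
  | _, .app f args => N.funMap f fun s' p => (args s' p).eval N e

/-- Truth of a formula under an assignment. -/
def Formula.Realize (N : Str.{u, v, w} L) :
    ∀ {Γ : List L.Srt}, Formula L Γ → Env N.carrier Γ → Prop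
  | _, .falsum, _ => False
  | _, .equal t₁ t₂, e => t₁.eval N e = t₂.eval N e
  | _, .rel R args, e => N.relMap R fun s p => (args s p).eval N e
  | _, .imp φ ψ, e => φ.Realize N e → ψ.Realize N e
  | _, .all s φ, e => ∀ x : N.carrier s, φ.Realize N (Env.cons x e)

/-- `M` and `N` satisfy the same sentences; in other words `N` is a model of `Th(M)`. -/
def ElemEquiv (M N : Str.{u, v, w} L) : Prop :=
  ∀ φ : Formula L [], φ.Realize M Env.nil ↔ φ.Realize N Env.nil

/-- The syntactic data of a strictly definable real-valued function on the product of the sorts in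
`Γ`: a finite set of values and, for each value, a formula without parameters. -/
structure StrictReal (L : MSLanguage.{u, v}) (Γ : List L.Srt) where
  vals : Finset ℝ
  formula : ℝ → Formula L Γ

/-- In `N`, the function `f` of one variable takes only the finitely many values `d.vals`, and
`d.formula r` defines the set where it takes the value `r`. -/
def StrictReal.Defines₁ {s : L.Srt} (d : StrictReal L [s]) (N : Str.{u, v, w} L)
    (f : N.carrier s → ℝ) : Prop :=
  ∀ x, f x ∈ d.vals ∧ ∀ r ∈ d.vals, ((d.formula r).Realize N (env₁ x) ↔ f x = r)

/-- The same for functions of two variables. -/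
def StrictReal.Defines₂ {s s' : L.Srt} (d : StrictReal L [s, s']) (N : Str.{u, v, w} L)
    (f : N.carrier s → N.carrier s' → ℝ) : Prop :=
  ∀ x y, f x y ∈ d.vals ∧ ∀ r ∈ d.vals, ((d.formula r).Realize N (env₂ x y) ↔ f x y = r)

end MSLanguage

open MSLanguage

/-! ### Graded inverse systems -/

/-- The language `L` extends the language with sorts `S i` (`i : I`), binary relations `≤` between
`S i` and `S j` for `i ≤ j`, and a binary relation `E` on each `S i`. -/
structure GradedSymbols (L : MSLanguage.{u, v}) (I : Type t) [LE I] where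
  S : I → L.Srt
  le : ∀ {i j : I}, i ≤ j → L.Rel [S i, S j]
  E : ∀ i : I, L.Rel [S i, S i]

namespace GradedSymbols

variable {L : MSLanguage.{u, v}} {I : Type t} [PartialOrder I]
variable (P : GradedSymbols L I) (N : Str.{u, v, w} L)

/-- The elements of the sort `S i` in the structure `N`. -/
abbrev Elt (i : I) : Type w := N.carrier (P.S i)

/-- The relation `x ≤ y` for `x` in `S i` and `y` in `S j`, `i ≤ j`. -/
def Le {i j : I} (h : i ≤ j) (x : P.Elt N i) (y : P.Elt N j) : Prop :=
  N.relMap (P.le h) (env₂ x y)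

/-- The relation `E` on `S i`. -/
def Eqv {i : I} (x y : P.Elt N i) : Prop := N.relMap (P.E i) (env₂ x y)

/-- The type of `E`-classes in `S i`. -/
def Cls (i : I) : Type w := {a : Set (P.Elt N i) // ∃ x, a = {y | P.Eqv N x y}}

/-- The `E`-class `[x]`. -/
def cls {i : I} (x : P.Elt N i) : P.Cls N i := ⟨{y | P.Eqv N x y}, x, rfl⟩

variable {N}

/-- The order on `E`-classes that is induced by `≤`. -/
def ClsLe {i j : I} (h : i ≤ j) (a : P.Cls N i) (b : P.Cls N j) : Prop :=
  ∃ x ∈ a.1, ∃ y ∈ b.1, P.Le N h x y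

/-- `≥ ∩ (b × a)` is the graph of a surjection `b → a`. -/
def IsSurj {i j : I} (h : i ≤ j) (a : P.Cls N i) (b : P.Cls N j) : Prop :=
  (∀ y ∈ b.1, ∃! x, x ∈ a.1 ∧ P.Le N h x y) ∧ ∀ x ∈ a.1, ∃ y ∈ b.1, P.Le N h x y

/-- `≤ ∩ (a × b)` is the graph of a bijection `a → b`. -/
def IsBij {i j : I} (h : i ≤ j) (a : P.Cls N i) (b : P.Cls N j) : Prop :=
  (∀ x ∈ a.1, ∃! y, y ∈ b.1 ∧ P.Le N h x y) ∧ ∀ y ∈ b.1, ∃! x, x ∈ a.1 ∧ P.Le N h x y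

/-- `c` is the largest class of `S i` that lies below both `a` and `b`. -/
def IsMeet {i : I} (a b c : P.Cls N i) : Prop :=
  (P.ClsLe le_rfl c a ∧ P.ClsLe le_rfl c b) ∧
    ∀ d : P.Cls N i, P.ClsLe le_rfl d a → P.ClsLe le_rfl d b → P.ClsLe le_rfl d c

/-- `c` is the smallest class of `S k` that lies above both `a` and `b`. -/
def IsJoin {i j k : I} (hi : i ≤ k) (hj : j ≤ k) (a : P.Cls N i) (b : P.Cls N j)
    (c : P.Cls N k) : Prop :=
  (P.ClsLe hi a c ∧ P.ClsLe hj b c) ∧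
    ∀ d : P.Cls N k, P.ClsLe hi a d → P.ClsLe hj b d → P.ClsLe le_rfl c d

variable (N)

/-- `N` is an `I`-graded inverse system of finite sets. -/
structure IsFiniteSystem : Prop where
  equivalence : ∀ i, Equivalence (P.Eqv N (i := i))
  bounded : ∀ i, ∃ K : ℕ, 1 ≤ K ∧ ∀ a : P.Cls N i, a.1.encard ≤ K
  le_refl : ∀ i (x : P.Elt N i), P.Le N le_rfl x x
  le_antisymm : ∀ i (x y : P.Elt N i), P.Le N le_rfl x y → P.Le N le_rfl y x → x = y
  le_trans : ∀ {i j k} (h : i ≤ j) (h' : j ≤ k) (x : P.Elt N i) (y : P.Elt N j) (z : P.Elt N k),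
    P.Le N h x y → P.Le N h' y z → P.Le N (h.trans h') x z
  surj : ∀ {i j} (h : i ≤ j) (x : P.Elt N i) (y : P.Elt N j), P.Le N h x y →
    P.IsSurj h (P.cls N x) (P.cls N y)
  copy : ∀ {i j} (h : i ≤ j) (a : P.Cls N i), ∃! b : P.Cls N j, P.IsBij h a b
  copy_below : ∀ {i j} (h : i ≤ j) (a' : P.Cls N i) (a : P.Cls N j), P.IsBij h a' a →
    ∀ b : P.Cls N j, P.ClsLe le_rfl b a → ∃ b' : P.Cls N i, P.IsBij h b' b
  meet : ∀ {i} (a b : P.Cls N i), ∃! c : P.Cls N i, P.IsMeet a b c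
  join : ∀ i j, ∃ (k : I) (hi : i ≤ k) (hj : j ≤ k), ∀ (a : P.Cls N i) (b : P.Cls N j),
    ∃ c : P.Cls N k, P.IsJoin hi hj a b c

/-- `N`, with the functions `μ i : S i → [0, 1]`, is an `I`-graded inverse system of finite
probability spaces. Strict definability of the functions `μ i` is stated separately. -/
structure IsProbabilitySystem (μ : ∀ i, P.Elt N i → ℝ) : Prop extends P.IsFiniteSystem N where
  mem_unit : ∀ i x, μ i x ∈ Set.Icc (0 : ℝ) 1
  sum_one : ∀ i (a : P.Cls N i), ∑ᶠ x ∈ a.1, μ i x = 1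
  sum_fibre : ∀ {i j} (h : i ≤ j) (a : P.Cls N i) (b : P.Cls N j), P.ClsLe h a b →
    ∀ x ∈ a.1, μ i x = ∑ᶠ y ∈ {y | y ∈ b.1 ∧ P.Le N h x y}, μ j y

/-- `N` is a `2`-regular `I`-graded inverse system of finite probability spaces. The set
`{w | w ∈ c ∧ x ≤ w ∧ y ≤ w}` is `x ∨ y`. If `μ i z = 0`, then `μ i x = 0`, both sides of the last
equation vanish, and the equation is no condition. -/
structure IsTwoRegular (μ : ∀ i, P.Elt N i → ℝ) : Prop extends P.IsProbabilitySystem N μ where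
  two_regular : ∀ {i k} (h : i ≤ k),
    (∀ a b : P.Cls N i, ∃ c : P.Cls N k, P.IsJoin h h a b c) →
    ∀ (a b m : P.Cls N i) (c : P.Cls N k), P.IsMeet a b m → P.IsJoin h h a b c →
    ∀ x ∈ a.1, ∀ y ∈ b.1, {w | w ∈ c.1 ∧ P.Le N h x w ∧ P.Le N h y w}.Nonempty →
    ∀ z ∈ m.1, P.Le N le_rfl z x → P.Le N le_rfl z y →
      ∑ᶠ w ∈ {w | w ∈ c.1 ∧ P.Le N h x w ∧ P.Le N h y w}, μ k w = μ i x * μ i y / μ i z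

/-! ### The inverse limit and its `L²`-space -/

/-- The inverse limit of the system of all `E`-classes: coherent choices of one element in every
class. -/
def Lim : Type (max t w) :=
  {f : ∀ i, P.Cls N i → P.Elt N i // (∀ i a, f i a ∈ a.1) ∧
    ∀ {i j} (h : i ≤ j) (a : P.Cls N i) (b : P.Cls N j), P.ClsLe h a b → P.Le N h (f i a) (f j b)}

/-- The `σ`-algebra generated by the projections of the inverse limit to the finite (discrete)
classes. -/
instance : MeasurableSpace (P.Lim N) :=
  ⨆ (i : I) (a : P.Cls N i), MeasurableSpace.comap (fun ω : P.Lim N => ω.1 i a) ⊤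

variable {N}

/-- The fibre over `x` of the projection of the inverse limit to the class `[x]`. -/
def cyl {i : I} (x : P.Elt N i) : Set (P.Lim N) := {ω | ω.1 i (P.cls N x) = x}

theorem measurableSet_cyl {i : I} (x : P.Elt N i) : MeasurableSet (P.cyl x) := by
  have h : MeasurableSpace.comap (fun ω : P.Lim N => ω.1 i (P.cls N x)) ⊤ ≤
      (inferInstance : MeasurableSpace (P.Lim N)) :=
    le_iSup₂ (f := fun (i : I) (a : P.Cls N i) =>
      MeasurableSpace.comap (fun ω : P.Lim N => ω.1 i a) ⊤) i (P.cls N x)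
  exact h _ ⟨{x}, trivial, rfl⟩

/-- `Q` is the probability measure on the inverse limit that projects to `μ` on every class. -/
def IsLimitMeasure (μ : ∀ i, P.Elt N i → ℝ) (Q : ProbabilityMeasure (P.Lim N)) : Prop :=
  ∀ i (x : P.Elt N i), (Q : Measure (P.Lim N)).real (P.cyl x) = μ i x

variable (Q : ProbabilityMeasure (P.Lim N))

/-- The real Hilbert space `L²` of the inverse limit. -/
abbrev L2 : Type (max t w) := Lp ℝ 2 (Q : Measure (P.Lim N))

/-- The vector of `L²` with which the element `x` is identified: the indicator function of the
fibre over `x`. -/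
noncomputable def vec {i : I} (x : P.Elt N i) : P.L2 Q :=
  indicatorConstLp 2 (P.measurableSet_cyl x)
    (measure_ne_top (Q : Measure (P.Lim N)) (P.cyl x)) (1 : ℝ)

/-- The space `W[x]` spanned by the elements of the classes `b < [x]` of the sort of `x`. -/
noncomputable def lower {i : I} (x : P.Elt N i) : Submodule ℝ (P.L2 Q) :=
  Submodule.span ℝ {ξ | ∃ b : P.Cls N i, P.ClsLe le_rfl b (P.cls N x) ∧ b ≠ P.cls N x ∧
    ∃ y ∈ b.1, ξ = P.vec Q y}

/-- The vector `P_{W[x]^⊥} x`. -/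
noncomputable def resid {i : I} (x : P.Elt N i) : P.L2 Q :=
  (P.lower Q x)ᗮ.starProjection (P.vec Q x)

end GradedSymbols

/-! ### Hilbert spaces -/

/-- `W` is the completed orthogonal sum of the family of subspaces `V`. -/
def IsCompletedOrthogonalSum {H : Type*} [NormedAddCommGroup H] [InnerProductSpace ℝ H]
    {ι : Type*} (V : ι → Submodule ℝ H) (W : Submodule ℝ H) : Prop :=
  (∀ i, IsClosed (V i : Set H)) ∧ (Pairwise fun i j => V i ⟂ V j) ∧
    (⨆ i, V i).topologicalClosure = W

/-- The set of vectors `D` (the points of a definable set in one model) is asymptotically free. -/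
def IsAsymptoticallyFree {H : Type*} [NormedAddCommGroup H] [InnerProductSpace ℝ H]
    (D : Set H) : Prop :=
  ∀ x ∈ D, ∀ ε : ℝ, 0 < ε → IsCompact {y | y ∈ D ∧ ε ≤ |inner ℝ x y|}

/-! ### The decomposition -/

namespace GradedSymbols

variable {L : MSLanguage.{u, v}} {I : Type t} [PartialOrder I]

/-- The formulas, without parameters, that give the definable sets `D i` in all models at once:
`eqv i` is to define the equivalence relation on `S i` whose quotient is the classical imaginary
sort that contains `D i`, and `dom i` the set of elements of `S i` whose images in that sort form
`D i`; `innSelf` and `innSort` are to define the inner product maps between these imaginary sorts,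
and between them and the sorts `S j`. -/
structure Pieces (P : GradedSymbols L I) where
  eqv : ∀ i, Formula L [P.S i, P.S i]
  dom : ∀ i, Formula L [P.S i]
  innSelf : ∀ i j, StrictReal L [P.S i, P.S j]
  innSort : ∀ i j, StrictReal L [P.S i, P.S j]

namespace Pieces

variable {P : GradedSymbols L I} (D : P.Pieces) {N : Str.{u, v, w} L}
variable (Q : ProbabilityMeasure (P.Lim N))

/-- The set `D i`, as a set of vectors of `L²`: the class of `x` is identified with
`P_{W[x]^⊥} x`. -/
def points (i : I) : Set (P.L2 Q) :=
  {ξ | ∃ x : P.Elt N i, (D.dom i).Realize N (env₁ x) ∧ ξ = P.resid Q x}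

/-- The closed subspace `V i` generated by `D i`. -/
noncomputable def space (i : I) : Submodule ℝ (P.L2 Q) :=
  (Submodule.span ℝ (D.points Q i)).topologicalClosure

/-- The subspace generated by the part of `D i` that comes from the `E`-class `a`. -/
noncomputable def block (i : I) (a : P.Cls N i) : Submodule ℝ (P.L2 Q) :=
  Submodule.span ℝ {ξ | ∃ x ∈ a.1, (D.dom i).Realize N (env₁ x) ∧ ξ = P.resid Q x}

/-- In the model `N`, the sets `D i` decompose `L²` of the inverse limit. -/
structure Decompose : Prop where
  /-- The imaginary sort `S i / eqv i` is identified with a set of vectors by `P_{W[x]^⊥} x`. -/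
  eqv_iff : ∀ i (x y : P.Elt N i),
    (D.eqv i).Realize N (env₂ x y) ↔ P.resid Q x = P.resid Q y
  /-- The inner product maps between these imaginary sorts are strictly definable. -/
  strict_self : ∀ i j, (D.innSelf i j).Defines₂ N
    fun x y => inner ℝ (P.resid Q x) (P.resid Q y)
  /-- So are those with the generating pieces `S j` of `L²`. -/
  strict_sort : ∀ i j, (D.innSort i j).Defines₂ N
    fun x y => inner ℝ (P.resid Q x) (P.vec Q y)
  asymptotically_free : ∀ i, IsAsymptoticallyFree (D.points Q i)
  finite_dimensional : ∀ i a, FiniteDimensional ℝ (D.block Q i a)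
  space_sum : ∀ i, IsCompletedOrthogonalSum (D.block Q i) (D.space Q i)
  total_sum : IsCompletedOrthogonalSum (D.space Q) ⊤

end Pieces

end GradedSymbols

/-!
The proof has a geometric part, carried out in one model `N`, and a logical part, which shows that
everything is uniform in `N`.

*Geometry.* By compactness, the projections of the inverse limit to the classes are surjective and a
decreasing sequence of non-empty cylinder sets has a common point (`exists_lim_eq`,
`nonempty_iInter_cylinders`). Hence the weights define a content on the ring of cylinder sets which
is continuous at `∅`, and Carathéodory's theorem gives the measure. Let `W_a ⊆ L²` be the span of a
class `a`. Regularity says that two classes `a` and `b` of one sort are independent over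
their meet: every vector of `W_b` is, modulo `(W_a)^⊥`, a vector of `W_{a ∧ b}`
(`exists_sub_orthogonal`). Consequently `P_{W[x]^⊥} x` is orthogonal to `W_d` for every class `d` of
the same sort that does not lie above `[x]` (`resid_mem_orthogonal_clsSpan`). This gives the
orthogonality of the blocks in one sort, and asymptotic freeness, because only the finitely many
elements of `[x]` contribute. If `[x]` is not a copy of a class of `S j`, then by axiom (3) no copy
in the sort of `x` of a class of `S j` lies above `[x]`, so `P_{W[x]^⊥} x` is orthogonal to all of
`S j`.

The set `D i` is therefore defined along an increasing cofinal sequence of indices: it consists of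
the elements whose class is not a copy from the preceding index of the sequence, and it is empty for
indices off the sequence (`IsNew`). Here countable cofinality is used: "not a copy from any smaller
index" would not be a first-order condition. The pieces `V i` are pairwise orthogonal,
and an induction along the sequence and on the size of classes shows that they generate every `W_a`;
sizes decrease strictly because each class is its own unique copy in its sort.

*Logic.* A predicate is called uniformly definable over a family of structures (`Dfn`) if one
formula defines it in all of them, and a function is called finitely definable (`FinDef`) if it has
finitely many values and uniformly definable level sets. Every axiom of a `2`-regular system
is a uniformly definable sentence, so the axioms pass to all models of the theory
(`IsTwoRegular.transfer`). A function that is determined by finitely definable data of an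
enumeration of a definable set of bounded size is finitely definable (`FinDef.of_enum`). For `x` and
`y` in one sort, `⟨P_{W[x]^⊥} x, y⟩` is such a function: it vanishes unless `[x] ≤ [y]`, and then
`x`, `y` and `W[x]` are given in the span of `[y]` by finite combinatorial data,
while the Gram matrix of `[y]` is given by the weights (`inner_eq_of_gram`).
Inner products between different sorts reduce to
this case, since passing to copies in a common larger sort changes neither `x` nor `P_{W[x]^⊥} x`
(`lower_eq_of_isBij`).
-/

/-! ### Uniform definability over a family of structures -/

namespace MSLanguage

variable {L : MSLanguage.{u, v}}

/-- Renamings of the variables of a context. -/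
abbrev Ren {S : Type u} (Γ Δ : List S) : Type u := ∀ s : S, Var Γ s → Var Δ s

/-- The extension of a renaming below a binder. -/
def Ren.lift {S : Type u} {Γ Δ : List S} (ρ : Ren Γ Δ) (s : S) : Ren (s :: Γ) (s :: Δ)
  | _, .zero => .zero
  | _, .succ p => .succ (ρ _ p)

/-- Renaming of variables in a term. -/
def Term.rename {Γ Δ : List L.Srt} (ρ : Ren Γ Δ) : ∀ {s : L.Srt}, Term L Γ s → Term L Δ s
  | _, .var p => .var (ρ _ p)
  | _, .app f args => .app f fun s' p => (args s' p).rename ρ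

/-- Renaming of free variables in a formula. -/
def Formula.rename : ∀ {Γ Δ : List L.Srt}, Ren Γ Δ → Formula L Γ → Formula L Δ
  | _, _, _, .falsum => .falsum
  | _, _, ρ, .equal t₁ t₂ => .equal (t₁.rename ρ) (t₂.rename ρ)
  | _, _, ρ, .rel R args => .rel R fun s p => (args s p).rename ρ
  | _, _, ρ, .imp φ ψ => .imp (φ.rename ρ) (ψ.rename ρ)
  | _, _, ρ, .all s φ => .all s (φ.rename (ρ.lift s))

theorem Term.eval_rename (N : Str.{u, v, w} L) {Γ Δ : List L.Srt} (ρ : Ren Γ Δ)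
    (e : Env N.carrier Δ) : ∀ {s : L.Srt} (t : Term L Γ s),
      (t.rename ρ).eval N e = t.eval N fun s p => e s (ρ s p)
  | _, .var p => rfl
  | _, .app f args => by
    simp only [Term.rename, Term.eval]
    congr 1
    funext s' p
    exact (args s' p).eval_rename N ρ e

theorem Formula.realize_rename (N : Str.{u, v, w} L) {Γ Δ : List L.Srt} (ρ : Ren Γ Δ)
    (φ : Formula L Γ) (e : Env N.carrier Δ) :
    (φ.rename ρ).Realize N e ↔ φ.Realize N fun s p => e s (ρ s p) := by
  induction φ generalizing Δ with
  | falsum => rfl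
  | equal t₁ t₂ => simp only [Formula.rename, Formula.Realize, Term.eval_rename]
  | rel R args => simp only [Formula.rename, Formula.Realize, Term.eval_rename]
  | imp φ ψ hφ hψ => simp only [Formula.rename, Formula.Realize, hφ, hψ]
  | all s φ h =>
    simp only [Formula.rename, Formula.Realize, h]
    refine forall_congr' fun x => iff_of_eq (congrArg _ ?_)
    funext s' p
    cases p <;> rfl

/-- A predicate `R` on assignments, given in every structure of the family `str`, is uniformly
definable if one formula without parameters defines it in all these structures. -/
def Dfn {𝒦 : Type*} (str : 𝒦 → Str.{u, v, w} L) (Γ : List L.Srt)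
    (R : ∀ k, Env (str k).carrier Γ → Prop) : Prop :=
  ∃ φ : Formula L Γ, ∀ k e, φ.Realize (str k) e ↔ R k e

/-- A function on assignments, given in every structure of the family `str`, is finitely definable
if it takes finitely many values over the whole family and its level sets are uniformly definable.
The values may be of any type; strictly definable functions are those with real values. -/
def FinDef {𝒦 : Type*} (str : 𝒦 → Str.{u, v, w} L) (Γ : List L.Srt) {T : Type*}
    (F : ∀ k, Env (str k).carrier Γ → T) : Prop :=
  (∃ s : Set T, s.Finite ∧ ∀ k e, F k e ∈ s) ∧ ∀ t, Dfn str Γ fun k e => F k e = t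

variable {𝒦 : Type*} {str : 𝒦 → Str.{u, v, w} L} {Γ Δ : List L.Srt}

namespace Dfn

theorem congr {R R' : ∀ k, Env (str k).carrier Γ → Prop} (h : Dfn str Γ R)
    (hR : ∀ k e, R k e ↔ R' k e) : Dfn str Γ R' :=
  h.imp fun _ hφ k e => (hφ k e).trans (hR k e)

theorem falsum : Dfn str Γ fun _ _ => False := ⟨.falsum, fun _ _ => Iff.rfl⟩

theorem imp {R R' : ∀ k, Env (str k).carrier Γ → Prop} (h : Dfn str Γ R) (h' : Dfn str Γ R') :
    Dfn str Γ fun k e => R k e → R' k e := by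
  obtain ⟨φ, hφ⟩ := h
  obtain ⟨ψ, hψ⟩ := h'
  exact ⟨.imp φ ψ, fun k e => imp_congr (hφ k e) (hψ k e)⟩

theorem not {R : ∀ k, Env (str k).carrier Γ → Prop} (h : Dfn str Γ R) :
    Dfn str Γ fun k e => ¬ R k e := h.imp falsum

theorem const (p : Prop) : Dfn str Γ fun _ _ => p := by
  by_cases h : p
  · exact (falsum.not).congr fun _ _ => by simp [h]
  · exact falsum.congr fun _ _ => by simp [h]

theorem and {R R' : ∀ k, Env (str k).carrier Γ → Prop} (h : Dfn str Γ R) (h' : Dfn str Γ R') :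
    Dfn str Γ fun k e => R k e ∧ R' k e :=
  (h.imp h'.not).not.congr fun _ _ => by tauto

theorem iff {R R' : ∀ k, Env (str k).carrier Γ → Prop} (h : Dfn str Γ R) (h' : Dfn str Γ R') :
    Dfn str Γ fun k e => (R k e ↔ R' k e) :=
  ((h.imp h').and (h'.imp h)).congr fun _ _ => by tauto

theorem all {s : L.Srt} {R : ∀ k, (str k).carrier s → Env (str k).carrier Γ → Prop}
    (h : Dfn str (s :: Γ) fun k e => R k (e s .zero) fun s' p => e s' (.succ p)) :
    Dfn str Γ fun k e => ∀ x, R k x e := by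
  obtain ⟨φ, hφ⟩ := h
  exact ⟨.all s φ, fun k e => forall_congr' fun x => hφ k (Env.cons x e)⟩

theorem ex {s : L.Srt} {R : ∀ k, (str k).carrier s → Env (str k).carrier Γ → Prop}
    (h : Dfn str (s :: Γ) fun k e => R k (e s .zero) fun s' p => e s' (.succ p)) :
    Dfn str Γ fun k e => ∃ x, R k x e :=
  (all (R := fun k x e => ¬ R k x e) h.not).not.congr fun _ _ => by simp

theorem all_finite {ι : Type*} [Finite ι] {R : ι → ∀ k, Env (str k).carrier Γ → Prop}
    (h : ∀ i, Dfn str Γ (R i)) : Dfn str Γ fun k e => ∀ i, R i k e := by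
  have key : ∀ l : List ι, Dfn str Γ fun k e => ∀ i ∈ l, R i k e := by
    intro l
    induction l with
    | nil => exact (const True).congr fun _ _ => by simp
    | cons i l ih => exact ((h i).and ih).congr fun _ _ => by simp
  cases nonempty_fintype ι
  exact (key Finset.univ.toList).congr fun _ _ => by simp

theorem ex_finite {ι : Type*} [Finite ι] {R : ι → ∀ k, Env (str k).carrier Γ → Prop}
    (h : ∀ i, Dfn str Γ (R i)) : Dfn str Γ fun k e => ∃ i, R i k e :=
  (all_finite fun i => (h i).not).not.congr fun _ _ => by simp

theorem rename {R : ∀ k, Env (str k).carrier Γ → Prop} (h : Dfn str Γ R) (ρ : Ren Γ Δ) :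
    Dfn str Δ fun k e => R k fun s p => e s (ρ s p) := by
  obtain ⟨φ, hφ⟩ := h
  exact ⟨φ.rename ρ, fun k e => (φ.realize_rename _ ρ e).trans (hφ k _)⟩

theorem eq_var {s : L.Srt} (p q : Var Γ s) : Dfn str Γ fun _ e => e s p = e s q :=
  ⟨.equal (.var p) (.var q), fun _ _ => Iff.rfl⟩

theorem rel₂ {s s' : L.Srt} (R : L.Rel [s, s']) (p : Var Γ s) (q : Var Γ s') :
    Dfn str Γ fun k e => (str k).relMap R (env₂ (e s p) (e s' q)) := by
  refine ⟨.rel R (Env.cons (A := Term L Γ) (.var p) (Env.cons (.var q) Env.nil)), fun k e => ?_⟩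
  change (str k).relMap R _ ↔ (str k).relMap R _
  refine iff_of_eq (congrArg _ ?_)
  funext s'' r
  rcases r with _ | r
  · rfl
  rcases r with _ | r
  · rfl
  · cases r

theorem realize₁ {s : L.Srt} (φ : Formula L [s]) (p : Var Γ s) :
    Dfn str Γ fun k e => φ.Realize (str k) (env₁ (e s p)) := by
  let ρ : Ren [s] Γ := fun s' q => Env.cons (A := Var Γ) p Env.nil s' q
  refine ⟨φ.rename ρ, fun k e => (Formula.realize_rename _ ρ φ e).trans ?_⟩
  refine iff_of_eq (congrArg _ ?_)
  funext s'' r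
  rcases r with _ | r
  · rfl
  · cases r

theorem existsUnique {s : L.Srt} {R : ∀ k, (str k).carrier s → Env (str k).carrier Γ → Prop}
    (h : Dfn str (s :: Γ) fun k e => R k (e s .zero) fun s' p => e s' (.succ p)) :
    Dfn str Γ fun k e => ∃! x, R k x e := by
  refine ex (R := fun k x e => R k x e ∧ ∀ y, R k y e → y = x) (h.and ?_)
  refine all (R := fun k y e => R k y (fun s' p => e s' (.succ p)) → y = e s .zero) (.imp ?_ ?_)
  · exact h.rename (Γ := s :: Γ) (Δ := s :: s :: Γ) (fun s' p => match s', p with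
      | _, .zero => .zero
      | _, .succ p => .succ (.succ p))
  · exact eq_var _ _

/-- Elementarily equivalent structures satisfy the same uniformly definable sentences. -/
theorem transfer {R : 𝒦 → Prop} (h : Dfn str [] fun k _ => R k) {k k' : 𝒦}
    (hk : ElemEquiv (str k) (str k')) (hR : R k) : R k' := by
  obtain ⟨φ, hφ⟩ := h
  exact (hφ k' Env.nil).1 ((hk φ).1 ((hφ k Env.nil).2 hR))

end Dfn

/-- The context `Γ` extended by `n` variables of sort `s`. -/
def tupleCtx (s : L.Srt) (n : ℕ) (Γ : List L.Srt) : List L.Srt := n.rec Γ fun _ Δ => s :: Δ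

/-- The additional variables of `tupleCtx s n Γ`. -/
def tupleVar (s : L.Srt) (Γ : List L.Srt) : ∀ n : ℕ, Fin n → Var (tupleCtx s n Γ) s
  | 0 => Fin.elim0
  | n + 1 => Fin.cons .zero fun i => .succ (tupleVar s Γ n i)

/-- The old variables of `tupleCtx s n Γ`. -/
def tupleWk (s : L.Srt) (Γ : List L.Srt) : ∀ n : ℕ, Ren Γ (tupleCtx s n Γ)
  | 0 => fun _ p => p
  | n + 1 => fun s' p => .succ (tupleWk s Γ n s' p)

theorem exists_env_tuple {S : L.Srt → Type w} (s : L.Srt) (Γ : List L.Srt) (n : ℕ)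
    (x : Fin n → S s) (e : Env S Γ) : ∃ e' : Env S (tupleCtx s n Γ),
      (fun i => e' s (tupleVar s Γ n i)) = x ∧ (fun s' p => e' s' (tupleWk s Γ n s' p)) = e := by
  induction n with
  | zero => exact ⟨e, funext fun i => i.elim0, rfl⟩
  | succ n ih =>
    obtain ⟨e', h₁, h₂⟩ := ih (Fin.tail x)
    refine ⟨Env.cons (x 0) e', funext fun i => ?_, h₂⟩
    refine Fin.cases rfl (fun i => ?_) i
    exact congrFun h₁ i

theorem Dfn.ex_tuple {s : L.Srt} (n : ℕ)
    {R : ∀ k, (Fin n → (str k).carrier s) → Env (str k).carrier Γ → Prop}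
    (h : Dfn str (tupleCtx s n Γ) fun k e =>
      R k (fun i => e s (tupleVar s Γ n i)) fun s' p => e s' (tupleWk s Γ n s' p)) :
    Dfn str Γ fun k e => ∃ x, R k x e := by
  induction n with
  | zero =>
    refine h.congr fun k e => ?_
    refine ⟨fun h => ⟨_, h⟩, fun ⟨x, hx⟩ => ?_⟩
    rwa [Subsingleton.elim x fun i => e s (tupleVar s Γ 0 i)] at hx
  | succ n ih =>
    have := @ih (fun k x' e => ∃ x, R k (Fin.cons x x') e) <|
      Dfn.ex (R := fun k x e => R k (Fin.cons x fun i => e s (tupleVar s Γ n i))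
        fun s' p => e s' (tupleWk s Γ n s' p)) <| h.congr fun k e => iff_of_eq <| by
        congr 1
        funext i
        exact Fin.cases rfl (fun i => rfl) i
    refine this.congr fun k e => ⟨fun ⟨x', x, hx⟩ => ⟨_, hx⟩, fun ⟨x, hx⟩ => ⟨Fin.tail x, x 0, ?_⟩⟩
    rwa [Fin.cons_self_tail]

namespace FinDef

theorem congr {T : Type*} {F F' : ∀ k, Env (str k).carrier Γ → T} (h : FinDef str Γ F)
    (hF : ∀ k e, F k e = F' k e) : FinDef str Γ F' := by
  obtain rfl : F = F' := funext fun k => funext (hF k)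
  exact h

theorem of_dfn {R : ∀ k, Env (str k).carrier Γ → Prop} (h : Dfn str Γ R) : FinDef str Γ R :=
  ⟨⟨Set.univ, Set.finite_univ, fun _ _ => trivial⟩,
    fun t => (h.iff (Dfn.const t)).congr fun _ _ => propext_iff.symm⟩

theorem pi {ι : Type*} [Finite ι] {T : ι → Type*} {F : ∀ i, ∀ k, Env (str k).carrier Γ → T i}
    (h : ∀ i, FinDef str Γ (F i)) : FinDef str Γ fun k e i => F i k e := by
  choose s hs hF using fun i => (h i).1
  exact ⟨⟨Set.univ.pi s, Set.Finite.pi' hs |>.subset fun f hf i => hf i trivial,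
    fun k e i _ => hF i k e⟩,
    fun t => (Dfn.all_finite fun i => (h i).2 (t i)).congr fun _ _ => funext_iff.symm⟩

theorem prod {T T' : Type*} {F : ∀ k, Env (str k).carrier Γ → T}
    {F' : ∀ k, Env (str k).carrier Γ → T'} (h : FinDef str Γ F) (h' : FinDef str Γ F') :
    FinDef str Γ fun k e => (F k e, F' k e) := by
  obtain ⟨s, hs, hF⟩ := h.1
  obtain ⟨s', hs', hF'⟩ := h'.1
  exact ⟨⟨s ×ˢ s', hs.prod hs', fun k e => ⟨hF k e, hF' k e⟩⟩,
    fun t => ((h.2 t.1).and (h'.2 t.2)).congr fun k e =>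
      (Prod.ext_iff (x := (F k e, F' k e)) (y := t)).symm⟩

theorem dfn_comp {T : Type*} {F : ∀ k, Env (str k).carrier Γ → T} (h : FinDef str Γ F)
    (p : T → Prop) : Dfn str Γ fun k e => p (F k e) := by
  obtain ⟨s, hs, hF⟩ := h.1
  have : Finite {t // t ∈ s ∧ p t} :=
    (hs.subset fun _ h => h.1 : {t | t ∈ s ∧ p t}.Finite).to_subtype
  refine (Dfn.ex_finite fun t : {t // t ∈ s ∧ p t} => h.2 t.1).congr fun k e => ?_
  exact ⟨fun ⟨t, ht⟩ => ht ▸ t.2.2, fun ht => ⟨⟨F k e, hF k e, ht⟩, rfl⟩⟩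

theorem comp {T T' : Type*} {F : ∀ k, Env (str k).carrier Γ → T} (h : FinDef str Γ F)
    (c : T → T') : FinDef str Γ fun k e => c (F k e) := by
  obtain ⟨s, hs, hF⟩ := h.1
  exact ⟨⟨c '' s, hs.image c, fun k e => ⟨_, hF k e, rfl⟩⟩, fun t => h.dfn_comp fun x => c x = t⟩

/-- A function that depends only on the value of a finitely definable function is finitely
definable. -/
theorem factor {T T' : Type*} [Nonempty T'] {F : ∀ k, Env (str k).carrier Γ → T}
    (h : FinDef str Γ F) {G : ∀ k, Env (str k).carrier Γ → T'}
    (hG : ∀ k e k' e', F k e = F k' e' → G k e = G k' e') : FinDef str Γ G := by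
  classical
  let c : T → T' := fun t =>
    if h : ∃ k e, F k e = t then G h.choose h.choose_spec.choose else Classical.arbitrary T'
  refine (h.comp c).congr fun k e => ?_
  have hk : ∃ k' e', F k' e' = F k e := ⟨k, e, rfl⟩
  simp only [c, dif_pos hk]
  exact hG _ _ _ _ hk.choose_spec.choose_spec

theorem rename {T : Type*} {F : ∀ k, Env (str k).carrier Γ → T} (h : FinDef str Γ F)
    (ρ : Ren Γ Δ) : FinDef str Δ fun k e => F k fun s p => e s (ρ s p) :=
  ⟨h.1.imp fun _ hs => ⟨hs.1, fun k _ => hs.2 k _⟩, fun t => (h.2 t).rename ρ⟩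

/-- The set of the values of a finitely definable function on a fibre of a definable set of tuples
is finitely definable. -/
theorem image_tuple {s : L.Srt} (n : ℕ) {T : Type*}
    {R : ∀ k, (Fin n → (str k).carrier s) → Env (str k).carrier Γ → Prop}
    {F : ∀ k, (Fin n → (str k).carrier s) → Env (str k).carrier Γ → T}
    (hR : Dfn str (tupleCtx s n Γ) fun k e =>
      R k (fun i => e s (tupleVar s Γ n i)) fun s' p => e s' (tupleWk s Γ n s' p))
    (hF : FinDef str (tupleCtx s n Γ) fun k e =>
      F k (fun i => e s (tupleVar s Γ n i)) fun s' p => e s' (tupleWk s Γ n s' p)) :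
    FinDef str Γ fun k e => {d | ∃ x, R k x e ∧ F k x e = d} := by
  obtain ⟨V, hV, hFV⟩ := hF.1
  have hmem : ∀ k x e, F k x e ∈ V := fun k x e => by
    obtain ⟨e', rfl, rfl⟩ := exists_env_tuple s Γ n x e
    exact hFV k e'
  have hfin := hV.to_subtype
  have hV' : FinDef str Γ fun k e (d : V) => ∃ x, R k x e ∧ F k x e = d :=
    pi fun d => of_dfn (Dfn.ex_tuple n (R := fun k x e => R k x e ∧ F k x e = d)
      (hR.and (hF.2 d)))
  refine (hV'.comp fun f : V → Prop => {d : T | ∃ h : d ∈ V, f ⟨d, h⟩}).congr fun k e => ?_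
  ext d
  exact ⟨fun ⟨_, h⟩ => h, fun ⟨x, hx, hd⟩ => ⟨hd ▸ hmem k x e, x, hx, hd⟩⟩

end FinDef

/-- `x` enumerates the set `A` without repetitions. -/
def Enumerates {α : Type*} {n : ℕ} (x : Fin n → α) (A : Set α) : Prop :=
  Function.Injective x ∧ ∀ y, y ∈ A ↔ ∃ i, x i = y

theorem exists_enumerates {α : Type*} {A : Set α} {B : ℕ} (h : A.encard ≤ B) :
    ∃ n < B + 1, ∃ x : Fin n → α, Enumerates x A := by
  have hA : A.Finite := Set.finite_of_encard_le_coe h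
  obtain ⟨n, x, hx⟩ := hA.fin_param
  refine ⟨n, ?_, x, hx.1, fun y => by rw [← hx.2]; rfl⟩
  rw [← hx.2, ← Set.image_univ, hx.1.encard_image, Set.encard_univ] at h
  simp only [ENat.card_eq_coe_fintype_card, Fintype.card_fin] at h
  exact Nat.lt_succ_of_le (by exact_mod_cast h)

theorem Enumerates.dfn {s : L.Srt} {R : ∀ k, (str k).carrier s → Env (str k).carrier Γ → Prop}
    (hR : Dfn str (s :: Γ) fun k e => R k (e s .zero) fun s' p => e s' (.succ p)) (n : ℕ) :
    Dfn str (tupleCtx s n Γ) fun k e => Enumerates (fun i => e s (tupleVar s Γ n i))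
      {y | R k y fun s' p => e s' (tupleWk s Γ n s' p)} := by
  refine .and ?_ ?_
  · exact .all_finite fun i => .all_finite fun j => .imp (.eq_var _ _) (.const _)
  · refine Dfn.all (R := fun k y e => (R k y fun s' p => e s' (tupleWk s Γ n s' p)) ↔ _) ?_
    refine .iff ?_ (.ex_finite fun i => .eq_var _ _)
    exact hR.rename (fun s' p => match s', p with
      | _, .zero => .zero
      | _, .succ p => .succ (tupleWk s Γ n _ p))

/-- Let `R` be a definable set with at most `B` elements. A function that is determined by
finitely definable data of any enumeration of `R` is finitely definable. -/
theorem FinDef.of_enum {s : L.Srt} {R : ∀ k, (str k).carrier s → Env (str k).carrier Γ → Prop}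
    (hR : Dfn str (s :: Γ) fun k e => R k (e s .zero) fun s' p => e s' (.succ p)) {B : ℕ}
    (hB : ∀ k e, {y | R k y e}.encard ≤ B) {T : ℕ → Type*}
    {F : ∀ n k, (Fin n → (str k).carrier s) → Env (str k).carrier Γ → T n}
    (hF : ∀ n, FinDef str (tupleCtx s n Γ) fun k e =>
      F n k (fun i => e s (tupleVar s Γ n i)) fun s' p => e s' (tupleWk s Γ n s' p))
    {T' : Type*} [Nonempty T'] {G : ∀ k, Env (str k).carrier Γ → T'}
    (hG : ∀ n k e x k' e' x', Enumerates x {y | R k y e} → Enumerates x' {y | R k' y e'} →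
      F n k x e = F n k' x' e' → G k e = G k' e') : FinDef str Γ G := by
  have := FinDef.pi fun n : Fin (B + 1) => FinDef.image_tuple (n : ℕ)
    (R := fun k x e => Enumerates x {y | R k y e}) (F := F n) (Enumerates.dfn hR n) (hF n)
  refine this.factor fun k e k' e' h => ?_
  obtain ⟨n, hn, x, hx⟩ := exists_enumerates (hB k e)
  have hmem : F n k x e ∈ {d | ∃ x, Enumerates x {y | R k y e} ∧ F n k x e = d} := ⟨x, hx, rfl⟩
  rw [congrFun h ⟨n, hn⟩] at hmem
  obtain ⟨x', hx', hxx'⟩ := hmem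
  exact hG n k e x k' e' x' hx hx' hxx'.symm

theorem Enumerates.finsum_mem {α : Type*} {n : ℕ} {x : Fin n → α} {A : Set α}
    (h : Enumerates x A) (f : α → ℝ) : ∑ᶠ y ∈ A, f y = ∑ i, f (x i) := by
  have hA : A = Set.range x := Set.ext fun y => (h.2 y).trans Iff.rfl
  rw [hA, finsum_mem_range h.1, finsum_eq_sum_of_fintype]

/-- Sums of finitely definable real functions over definable sets of bounded size are finitely
definable. -/
theorem FinDef.finsum_mem {s : L.Srt}
    {R : ∀ k, (str k).carrier s → Env (str k).carrier Γ → Prop}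
    (hR : Dfn str (s :: Γ) fun k e => R k (e s .zero) fun s' p => e s' (.succ p)) {B : ℕ}
    (hB : ∀ k e, {y | R k y e}.encard ≤ B)
    {f : ∀ k, (str k).carrier s → Env (str k).carrier Γ → ℝ}
    (hf : FinDef str (s :: Γ) fun k e => f k (e s .zero) fun s' p => e s' (.succ p)) :
    FinDef str Γ fun k e => ∑ᶠ y ∈ {y | R k y e}, f k y e := by
  refine FinDef.of_enum hR hB (F := fun n k x e i => f k (x i) e)
    (fun n => .pi fun i => ?_) fun n k e x k' e' x' hx hx' h => ?_
  · exact hf.rename (fun s' p => match s', p with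
      | _, .zero => tupleVar s Γ n i
      | _, .succ p => tupleWk s Γ n _ p)
  · rw [hx.finsum_mem, hx'.finsum_mem]
    exact Finset.sum_congr rfl fun i _ => congrFun h i

theorem Dfn.encard_le {s : L.Srt} {R : ∀ k, (str k).carrier s → Env (str k).carrier Γ → Prop}
    (hR : Dfn str (s :: Γ) fun k e => R k (e s .zero) fun s' p => e s' (.succ p)) (B : ℕ) :
    Dfn str Γ fun k e => {y | R k y e}.encard ≤ B := by
  refine (Dfn.ex_finite fun n : Fin (B + 1) =>
    Dfn.ex_tuple (R := fun k x e => Enumerates x {y | R k y e}) n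
      (Enumerates.dfn hR n)).congr fun k e => ⟨fun ⟨n, x, hx⟩ => ?_, fun h => ?_⟩
  · have hA : {y | R k y e} = Set.range x := Set.ext fun y => (hx.2 y).trans Iff.rfl
    rw [hA, ← Set.image_univ, hx.1.encard_image, Set.encard_univ]
    simp only [ENat.card_eq_coe_fintype_card, Fintype.card_fin]
    exact_mod_cast Nat.le_of_lt_succ n.2
  · obtain ⟨n, hn, x, hx⟩ := exists_enumerates h
    exact ⟨⟨n, hn⟩, x, hx⟩

/-- A finitely definable real function of two variables is strictly definable, with the same values
and formulas in all structures of the family. -/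
theorem FinDef.exists_strictReal {s s' : L.Srt}
    {F : ∀ k, (str k).carrier s → (str k).carrier s' → ℝ}
    (h : FinDef str [s, s'] fun k e => F k (e s .zero) (e s' (.succ .zero))) :
    ∃ d : StrictReal L [s, s'], ∀ k, d.Defines₂ (str k) (F k) := by
  obtain ⟨V, hV, hF⟩ := h.1
  choose φ hφ using h.2
  exact ⟨⟨hV.toFinset, φ⟩, fun k x y => ⟨hV.mem_toFinset.2 (hF k (env₂ x y)), fun r _ => hφ r k _⟩⟩

end MSLanguage

/-! ### Transfer of the axioms to elementarily equivalent structures -/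

namespace MSLanguage

variable {L : MSLanguage.{u, v}}

/-- In `N`, exactly one of the formulas of `d` holds at each element. -/
def StrictReal.IsFunctional {s : L.Srt} (d : StrictReal L [s]) (N : Str.{u, v, w} L) : Prop :=
  ∀ x : N.carrier s, ∃ r : d.vals, (d.formula r).Realize N (env₁ x) ∧
    ∀ r' : d.vals, (d.formula r').Realize N (env₁ x) → r' = r

open Classical in
/-- The function that is defined by `d` in `N`; its value is `0` where no formula of `d` holds. -/
noncomputable def StrictReal.value {s : L.Srt} (d : StrictReal L [s]) (N : Str.{u, v, w} L)
    (x : N.carrier s) : ℝ :=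
  if h : ∃ r : d.vals, (d.formula r).Realize N (env₁ x) then h.choose else 0

theorem StrictReal.IsFunctional.defines {s : L.Srt} {d : StrictReal L [s]} {N : Str.{u, v, w} L}
    (h : d.IsFunctional N) : d.Defines₁ N (d.value N) := by
  intro x
  obtain ⟨r, hr, hr'⟩ := h x
  have hex : ∃ r : d.vals, (d.formula r).Realize N (env₁ x) := ⟨r, hr⟩
  have hv : d.value N x = r := by
    rw [StrictReal.value, dif_pos hex]
    exact congrArg _ (hr' _ hex.choose_spec)
  refine ⟨hv ▸ r.2, fun t ht => ⟨fun h => ?_, fun h => ?_⟩⟩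
  · rw [hv]
    exact (congrArg Subtype.val (hr' ⟨t, ht⟩ h)).symm
  · rw [← h, hv]
    exact hr

theorem StrictReal.Defines₁.isFunctional {s : L.Srt} {d : StrictReal L [s]} {N : Str.{u, v, w} L}
    {f : N.carrier s → ℝ} (h : d.Defines₁ N f) : d.IsFunctional N := fun x =>
  ⟨⟨f x, (h x).1⟩, ((h x).2 _ (h x).1).2 rfl,
    fun r' hr' => Subtype.ext (((h x).2 r' r'.2).1 hr').symm⟩

theorem StrictReal.Defines₁.eq_value {s : L.Srt} {d : StrictReal L [s]} {N : Str.{u, v, w} L}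
    {f : N.carrier s → ℝ} (h : d.Defines₁ N f) : f = d.value N := funext fun x =>
  (((h.isFunctional.defines x).2 (f x) (h x).1).1 (((h x).2 _ (h x).1).2 rfl)).symm

variable {𝒦 : Type*} {str : 𝒦 → Str.{u, v, w} L} {Γ : List L.Srt}

theorem Dfn.isFunctional {s : L.Srt} (d : StrictReal L [s]) :
    Dfn str Γ fun k _ => d.IsFunctional (str k) :=
  .all (R := fun k x _ => ∃ r : d.vals, (d.formula r).Realize (str k) (env₁ x) ∧
    ∀ r' : d.vals, (d.formula r').Realize (str k) (env₁ x) → r' = r) <|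
  .ex_finite fun _ => .and (.realize₁ _ _) (.all_finite fun _ => .imp (.realize₁ _ _) (.const _))

theorem FinDef.value {s : L.Srt} {d : StrictReal L [s]} (h : ∀ k, d.IsFunctional (str k))
    (p : Var Γ s) : FinDef str Γ fun k e => d.value (str k) (e s p) := by
  refine ⟨⟨d.vals, d.vals.finite_toSet, fun k e => ((h k).defines _).1⟩, fun t => ?_⟩
  by_cases ht : t ∈ d.vals
  · exact (Dfn.realize₁ (d.formula t) p).congr fun k e => ((h k).defines _).2 t ht
  · exact Dfn.falsum.congr fun k e => ⟨False.elim, fun h' => ht (h' ▸ ((h k).defines _).1)⟩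

end MSLanguage

namespace GradedSymbols

variable {L : MSLanguage.{u, v}} {I : Type t} [PartialOrder I] {P : GradedSymbols L I}

theorem forall_cls {N : Str.{u, v, w} L} {i : I} {p : P.Cls N i → Prop} :
    (∀ a, p a) ↔ ∀ x, p (P.cls N x) :=
  ⟨fun h x => h _, fun h a => by obtain ⟨_, x, rfl⟩ := a; exact h x⟩

theorem exists_cls {N : Str.{u, v, w} L} {i : I} {p : P.Cls N i → Prop} :
    (∃ a, p a) ↔ ∃ x, p (P.cls N x) :=
  ⟨fun ⟨a, h⟩ => by obtain ⟨_, x, rfl⟩ := a; exact ⟨x, h⟩, fun ⟨x, h⟩ => ⟨_, h⟩⟩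

variable {𝒦 : Type*} {str : 𝒦 → Str.{u, v, w} L} {Γ : List L.Srt}

theorem dfn_le {i j : I} (h : i ≤ j) (p : Var Γ (P.S i)) (q : Var Γ (P.S j)) :
    Dfn str Γ fun k e => P.Le (str k) h (e _ p) (e _ q) := .rel₂ (P.le h) p q

theorem dfn_eqv {i : I} (p q : Var Γ (P.S i)) :
    Dfn str Γ fun k e => P.Eqv (str k) (e _ p) (e _ q) := .rel₂ (P.E i) p q

theorem dfn_mem {i : I} (p q : Var Γ (P.S i)) :
    Dfn str Γ fun k e => e _ p ∈ (P.cls (str k) (e _ q)).1 := dfn_eqv q p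

theorem dfn_cls_eq {i : I} (p q : Var Γ (P.S i)) :
    Dfn str Γ fun k e => P.cls (str k) (e _ p) = P.cls (str k) (e _ q) := by
  refine (Dfn.all (R := fun k x e => P.Eqv (str k) (e _ p) x ↔ P.Eqv (str k) (e _ q) x)
    (.iff (dfn_eqv _ _) (dfn_eqv _ _))).congr fun k e => ?_
  exact Iff.trans (b := {y | P.Eqv (str k) (e (P.S i) p) y} = {y | P.Eqv (str k) (e (P.S i) q) y})
    Set.ext_iff.symm ⟨fun h => Subtype.ext h, congrArg Subtype.val⟩

theorem dfn_all_cls {i : I} {R : ∀ k, P.Cls (str k) i → Env (str k).carrier Γ → Prop}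
    (h : Dfn str (P.S i :: Γ) fun k e =>
      R k (P.cls (str k) (e _ .zero)) fun s' p => e s' (.succ p)) :
    Dfn str Γ fun k e => ∀ a, R k a e :=
  (Dfn.all (R := fun k x e => R k (P.cls (str k) x) e) h).congr fun k e =>
    (forall_cls (p := fun a => R k a e)).symm

theorem dfn_ex_cls {i : I} {R : ∀ k, P.Cls (str k) i → Env (str k).carrier Γ → Prop}
    (h : Dfn str (P.S i :: Γ) fun k e =>
      R k (P.cls (str k) (e _ .zero)) fun s' p => e s' (.succ p)) :
    Dfn str Γ fun k e => ∃ a, R k a e :=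
  (Dfn.ex (R := fun k x e => R k (P.cls (str k) x) e) h).congr fun k e =>
    (exists_cls (p := fun a => R k a e)).symm

theorem dfn_existsUnique_cls {i : I} {R : ∀ k, P.Cls (str k) i → Env (str k).carrier Γ → Prop}
    (h : Dfn str (P.S i :: Γ) fun k e =>
      R k (P.cls (str k) (e _ .zero)) fun s' p => e s' (.succ p)) :
    Dfn str Γ fun k e => ∃! a, R k a e := by
  refine dfn_ex_cls (R := fun k a e => R k a e ∧ ∀ b, R k b e → b = a) (h.and ?_)
  refine dfn_all_cls (R := fun k b e => R k b (fun s' p => e s' (.succ p)) →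
    b = P.cls (str k) (e _ .zero)) (.imp ?_ (dfn_cls_eq _ _))
  exact h.rename (Γ := P.S i :: Γ) (Δ := P.S i :: P.S i :: Γ) (fun s' p => match s', p with
    | _, .zero => .zero
    | _, .succ p => .succ (.succ p))

theorem dfn_clsLe {i j : I} (h : i ≤ j) (p : Var Γ (P.S i)) (q : Var Γ (P.S j)) :
    Dfn str Γ fun k e => P.ClsLe h (P.cls (str k) (e _ p)) (P.cls (str k) (e _ q)) := by
  unfold ClsLe
  exact .ex (.and (dfn_mem _ _) (.ex (.and (dfn_mem _ _) (dfn_le _ _ _))))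

theorem dfn_isSurj {i j : I} (h : i ≤ j) (p : Var Γ (P.S i)) (q : Var Γ (P.S j)) :
    Dfn str Γ fun k e => P.IsSurj h (P.cls (str k) (e _ p)) (P.cls (str k) (e _ q)) := by
  unfold IsSurj
  exact .and (.all (.imp (dfn_mem _ _) (.existsUnique (.and (dfn_mem _ _) (dfn_le _ _ _)))))
    (.all (.imp (dfn_mem _ _) (.ex (.and (dfn_mem _ _) (dfn_le _ _ _)))))

theorem dfn_isBij {i j : I} (h : i ≤ j) (p : Var Γ (P.S i)) (q : Var Γ (P.S j)) :
    Dfn str Γ fun k e => P.IsBij h (P.cls (str k) (e _ p)) (P.cls (str k) (e _ q)) := by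
  unfold IsBij
  exact .and (.all (.imp (dfn_mem _ _) (.existsUnique (.and (dfn_mem _ _) (dfn_le _ _ _)))))
    (.all (.imp (dfn_mem _ _) (.existsUnique (.and (dfn_mem _ _) (dfn_le _ _ _)))))

theorem dfn_isMeet {i : I} (p q r : Var Γ (P.S i)) :
    Dfn str Γ fun k e => P.IsMeet (P.cls (str k) (e _ p)) (P.cls (str k) (e _ q))
      (P.cls (str k) (e _ r)) := by
  unfold IsMeet
  exact .and (.and (dfn_clsLe _ _ _) (dfn_clsLe _ _ _))
    (dfn_all_cls (.imp (dfn_clsLe _ _ _) (.imp (dfn_clsLe _ _ _) (dfn_clsLe _ _ _))))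

theorem dfn_isJoin {i j l : I} (hi : i ≤ l) (hj : j ≤ l) (p : Var Γ (P.S i)) (q : Var Γ (P.S j))
    (r : Var Γ (P.S l)) :
    Dfn str Γ fun k e => P.IsJoin hi hj (P.cls (str k) (e _ p)) (P.cls (str k) (e _ q))
      (P.cls (str k) (e _ r)) := by
  unfold IsJoin
  exact .and (.and (dfn_clsLe _ _ _) (dfn_clsLe _ _ _))
    (dfn_all_cls (.imp (dfn_clsLe _ _ _) (.imp (dfn_clsLe _ _ _) (dfn_clsLe _ _ _))))

theorem dfn_cls_encard_le (i : I) (K : ℕ) :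
    Dfn str Γ fun k _ => ∀ a : P.Cls (str k) i, a.1.encard ≤ K :=
  dfn_all_cls (Dfn.encard_le (R := fun k y e => y ∈ (P.cls (str k) (e _ .zero)).1)
    (dfn_mem _ _) K)

/-- For fixed indices, each axiom is a uniformly definable sentence. The bounds on the sizes of the
classes and the sorts that contain the joins are taken from `M`. -/
theorem IsFiniteSystem.transfer {M N : Str.{u, v, w} L} (hMN : ElemEquiv M N)
    (h : P.IsFiniteSystem M) : P.IsFiniteSystem N where
  equivalence i := by
    have hM := h.equivalence i
    refine ⟨?_, ?_, ?_⟩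
    · exact Dfn.transfer (str := id) (R := fun N => ∀ x, P.Eqv (i := i) N x x)
        (.all (dfn_eqv _ _)) hMN hM.refl
    · exact fun {x y} => Dfn.transfer (str := id)
        (R := fun N => ∀ x y, P.Eqv (i := i) N x y → P.Eqv N y x)
        (.all (.all (.imp (dfn_eqv _ _) (dfn_eqv _ _)))) hMN (fun _ _ => hM.symm) x y
    · exact fun {x y z} => Dfn.transfer (str := id)
        (R := fun N => ∀ x y z, P.Eqv (i := i) N x y → P.Eqv N y z → P.Eqv N x z)
        (.all (.all (.all (.imp (dfn_eqv _ _) (.imp (dfn_eqv _ _) (dfn_eqv _ _))))))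
        hMN (fun _ _ _ => hM.trans) x y z
  bounded i := by
    obtain ⟨K, hK, hM⟩ := h.bounded i
    exact ⟨K, hK, Dfn.transfer (str := id) (dfn_cls_encard_le i K) hMN hM⟩
  le_refl i := Dfn.transfer (str := id) (R := fun N => ∀ x : P.Elt N i, P.Le N le_rfl x x)
    (.all (dfn_le _ _ _)) hMN (h.le_refl i)
  le_antisymm i := Dfn.transfer (str := id)
    (R := fun N => ∀ x y : P.Elt N i, P.Le N le_rfl x y → P.Le N le_rfl y x → x = y)
    (.all (.all (.imp (dfn_le _ _ _) (.imp (dfn_le _ _ _) (.eq_var _ _))))) hMN (h.le_antisymm i)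
  le_trans {i j k} h₁ h₂ := Dfn.transfer (str := id)
    (R := fun N => ∀ (x : P.Elt N i) (y : P.Elt N j) (z : P.Elt N k),
      P.Le N h₁ x y → P.Le N h₂ y z → P.Le N (h₁.trans h₂) x z)
    (.all (.all (.all (.imp (dfn_le _ _ _) (.imp (dfn_le _ _ _) (dfn_le _ _ _))))))
    hMN (h.le_trans h₁ h₂)
  surj {i j} h₁ := Dfn.transfer (str := id)
    (R := fun N => ∀ (x : P.Elt N i) (y : P.Elt N j), P.Le N h₁ x y →
      P.IsSurj h₁ (P.cls N x) (P.cls N y))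
    (.all (.all (.imp (dfn_le _ _ _) (dfn_isSurj _ _ _)))) hMN (h.surj h₁)
  copy {i j} h₁ := Dfn.transfer (str := id)
    (R := fun N => ∀ a : P.Cls N i, ∃! b : P.Cls N j, P.IsBij h₁ a b)
    (dfn_all_cls (dfn_existsUnique_cls (dfn_isBij _ _ _))) hMN (h.copy h₁)
  copy_below {i j} h₁ := Dfn.transfer (str := id)
    (R := fun N => ∀ (a' : P.Cls N i) (a : P.Cls N j), P.IsBij h₁ a' a →
      ∀ b : P.Cls N j, P.ClsLe le_rfl b a → ∃ b' : P.Cls N i, P.IsBij h₁ b' b)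
    (dfn_all_cls (dfn_all_cls (.imp (dfn_isBij _ _ _) (dfn_all_cls (.imp (dfn_clsLe _ _ _)
      (dfn_ex_cls (dfn_isBij _ _ _))))))) hMN (h.copy_below h₁)
  meet {i} := Dfn.transfer (str := id)
    (R := fun N => ∀ a b : P.Cls N i, ∃! c : P.Cls N i, P.IsMeet a b c)
    (dfn_all_cls (dfn_all_cls (dfn_existsUnique_cls (dfn_isMeet _ _ _)))) hMN h.meet
  join i j := by
    obtain ⟨k, hi, hj, hM⟩ := h.join i j
    exact ⟨k, hi, hj, Dfn.transfer (str := id)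
      (R := fun N => ∀ (a : P.Cls N i) (b : P.Cls N j), ∃ c : P.Cls N k, P.IsJoin hi hj a b c)
      (dfn_all_cls (dfn_all_cls (dfn_ex_cls (dfn_isJoin _ _ _ _ _)))) hMN hM⟩

/-- The structures in which the strictly definable functions `m i` are functions and the sizes of
the classes of `S i` are bounded by `K i`. -/
structure Bounded (P : GradedSymbols L I) (m : ∀ i, StrictReal L [P.S i]) (K : I → ℕ) where
  str : Str.{u, v, w} L
  isFunctional : ∀ i, (m i).IsFunctional str
  encard_le : ∀ i (a : P.Cls str i), a.1.encard ≤ K i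

/-- The axioms on the weights are definable within the structures in which the classes are bounded
as in `M`, because finite sums of bounded length over definable sets are finitely definable. -/
theorem IsTwoRegular.transfer {M N : Str.{u, v, w} L} (hMN : ElemEquiv M N)
    (m : ∀ i, StrictReal L [P.S i]) {μ : ∀ i, P.Elt M i → ℝ} (hμ : ∀ i, (m i).Defines₁ M (μ i))
    (h : P.IsTwoRegular M μ) :
    (∀ i, (m i).IsFunctional N) ∧ P.IsTwoRegular N fun i => (m i).value N := by
  obtain rfl : μ = fun i => (m i).value M := funext fun i => (hμ i).eq_value
  choose K _ hK using h.bounded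
  let M' : P.Bounded m K := ⟨M, fun i => (hμ i).isFunctional, hK⟩
  let N' : P.Bounded m K := ⟨N, fun i => Dfn.transfer (str := id) (Dfn.isFunctional (m i)) hMN
    (hμ i).isFunctional, fun i => Dfn.transfer (str := id) (dfn_cls_encard_le i (K i)) hMN (hK i)⟩
  have hMN' : ElemEquiv M'.str N'.str := hMN
  let s : P.Bounded m K → Str.{u, v, w} L := Bounded.str
  have hv : ∀ {Γ : List L.Srt} {i : I} (p : Var Γ (P.S i)),
      FinDef s Γ fun k e => (m i).value k.str (e _ p) :=
    fun p => .value (fun k => k.isFunctional _) p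
  refine ⟨N'.isFunctional, { h.toIsFiniteSystem.transfer hMN with
    mem_unit := ?_, sum_one := ?_, sum_fibre := ?_, two_regular := ?_ }⟩
  · intro i
    exact Dfn.transfer (str := s) (k := M') (k' := N')
      (R := fun k => ∀ x, (m i).value k.str x ∈ Set.Icc (0 : ℝ) 1)
      (.all ((hv _).dfn_comp (· ∈ Set.Icc (0 : ℝ) 1))) hMN' (h.mem_unit i)
  · intro i
    exact Dfn.transfer (str := s) (k := M') (k' := N')
      (R := fun k => ∀ a : P.Cls k.str i, ∑ᶠ x ∈ a.1, (m i).value k.str x = 1)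
      (dfn_all_cls ((FinDef.finsum_mem (R := fun k y e => y ∈ (P.cls k.str (e _ .zero)).1)
        (dfn_mem _ _) (fun k e => k.encard_le i (P.cls k.str (e _ .zero)))
        (hv _)).dfn_comp (· = 1))) hMN' (h.sum_one i)
  · intro i j hij
    refine Dfn.transfer (str := s) (k := M') (k' := N')
      (R := fun k => ∀ (a : P.Cls k.str i) (b : P.Cls k.str j), P.ClsLe hij a b →
        ∀ x ∈ a.1, (m i).value k.str x =
          ∑ᶠ y ∈ {y | y ∈ b.1 ∧ P.Le k.str hij x y}, (m j).value k.str y)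
      (dfn_all_cls (dfn_all_cls (.imp (dfn_clsLe _ _ _) (.all (.imp (dfn_mem _ _) ?_)))))
      hMN' (h.sum_fibre hij)
    have hsum : FinDef s [P.S i, P.S j, P.S i] fun k e =>
        ∑ᶠ y ∈ {y | y ∈ (P.cls k.str (e _ (.succ .zero))).1 ∧ P.Le k.str hij (e _ .zero) y},
          (m j).value k.str y :=
      FinDef.finsum_mem (str := s) (R := fun k y e =>
          y ∈ (P.cls k.str (e _ (.succ .zero))).1 ∧ P.Le k.str hij (e _ .zero) y)
        (.and (dfn_mem _ _) (dfn_le _ _ _))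
        (fun k e => (Set.encard_le_encard fun y hy => hy.1).trans
          (k.encard_le j (P.cls k.str (e _ (.succ .zero))))) (hv _)
    exact ((hv .zero).prod hsum).dfn_comp fun r => r.1 = r.2
  · intro i j hij
    refine Dfn.transfer (str := s) (k := M') (k' := N')
      (R := fun k => (∀ a b : P.Cls k.str i, ∃ c : P.Cls k.str j, P.IsJoin hij hij a b c) →
        ∀ (a b m' : P.Cls k.str i) (c : P.Cls k.str j), P.IsMeet a b m' → P.IsJoin hij hij a b c →
        ∀ x ∈ a.1, ∀ y ∈ b.1,
          (∃ w, w ∈ c.1 ∧ P.Le k.str hij x w ∧ P.Le k.str hij y w) →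
        ∀ z ∈ m'.1, P.Le k.str le_rfl z x → P.Le k.str le_rfl z y →
          ∑ᶠ w ∈ {w | w ∈ c.1 ∧ P.Le k.str hij x w ∧ P.Le k.str hij y w}, (m j).value k.str w =
            (m i).value k.str x * (m i).value k.str y / (m i).value k.str z) ?_ hMN'
      (h.two_regular hij)
    refine .imp (dfn_all_cls (dfn_all_cls (dfn_ex_cls (dfn_isJoin _ _ _ _ _))))
      (dfn_all_cls (dfn_all_cls (dfn_all_cls (dfn_all_cls (.imp (dfn_isMeet _ _ _)
        (.imp (dfn_isJoin _ _ _ _ _) (.all (.imp (dfn_mem _ _) (.all (.imp (dfn_mem _ _)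
          (.imp (.ex (.and (dfn_mem _ _) (.and (dfn_le _ _ _) (dfn_le _ _ _)))) (.all
            (.imp (dfn_mem _ _) (.imp (dfn_le _ _ _) (.imp (dfn_le _ _ _) ?_)))))))))))))))
    have hsum : FinDef s [P.S i, P.S i, P.S i, P.S j, P.S i, P.S i, P.S i] fun k e =>
        ∑ᶠ w ∈ {w | w ∈ (P.cls k.str (e _ (.succ (.succ (.succ .zero))))).1 ∧
          P.Le k.str hij (e _ (.succ (.succ .zero))) w ∧ P.Le k.str hij (e _ (.succ .zero)) w},
          (m j).value k.str w :=
      FinDef.finsum_mem (str := s)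
        (R := fun k w e => w ∈ (P.cls k.str (e _ (.succ (.succ (.succ .zero))))).1 ∧
          P.Le k.str hij (e _ (.succ (.succ .zero))) w ∧ P.Le k.str hij (e _ (.succ .zero)) w)
        (.and (dfn_mem _ _) (.and (dfn_le _ _ _) (dfn_le _ _ _)))
        (fun k e => (Set.encard_le_encard fun y hy => hy.1).trans
          (k.encard_le j (P.cls k.str (e _ (.succ (.succ (.succ .zero))))))) (hv _)
    exact (hsum.prod ((hv (.succ (.succ .zero))).prod ((hv (.succ .zero)).prod
      (hv .zero)))).dfn_comp fun r => r.1 = r.2.1 * r.2.2.1 / r.2.2.2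

end GradedSymbols

/-! ### Classes of a finite system -/

namespace GradedSymbols

variable {L : MSLanguage.{u, v}} {I : Type t} [PartialOrder I] {P : GradedSymbols L I}
variable {N : Str.{u, v, w} L}

namespace IsFiniteSystem

variable (h : P.IsFiniteSystem N)
include h

theorem mem_cls {i : I} (x : P.Elt N i) : x ∈ (P.cls N x).1 := (h.equivalence i).refl x

theorem cls_eq {i : I} {a : P.Cls N i} {x : P.Elt N i} (hx : x ∈ a.1) : P.cls N x = a := by
  obtain ⟨_, z, rfl⟩ := a
  have hzx : P.Eqv N z x := hx
  exact Subtype.ext <| Set.ext fun y =>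
    ⟨fun hy => (h.equivalence i).trans hzx hy, fun hy =>
      (h.equivalence i).trans ((h.equivalence i).symm hzx) hy⟩

theorem nonempty {i : I} (a : P.Cls N i) : a.1.Nonempty := by
  obtain ⟨_, x, rfl⟩ := a
  exact ⟨x, h.mem_cls x⟩

theorem finite {i : I} (a : P.Cls N i) : a.1.Finite := by
  obtain ⟨K, -, hK⟩ := h.bounded i
  exact Set.finite_of_encard_le_coe (hK a)

theorem isSurj {i j : I} {hij : i ≤ j} {a : P.Cls N i} {b : P.Cls N j} (hab : P.ClsLe hij a b) :
    P.IsSurj hij a b := by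
  obtain ⟨x, hx, y, hy, hxy⟩ := hab
  have := h.surj hij x y hxy
  rwa [h.cls_eq hx, h.cls_eq hy] at this

theorem eq_of_le {i j : I} {hij : i ≤ j} {a : P.Cls N i} {b : P.Cls N j} (hab : P.ClsLe hij a b)
    {x x' : P.Elt N i} {y : P.Elt N j} (hy : y ∈ b.1) (hx : x ∈ a.1) (hxy : P.Le N hij x y)
    (hx' : x' ∈ a.1) (hxy' : P.Le N hij x' y) : x = x' :=
  ((h.isSurj hab).1 y hy).unique ⟨hx, hxy⟩ ⟨hx', hxy'⟩

theorem clsLe_refl {i : I} (a : P.Cls N i) : P.ClsLe le_rfl a a := by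
  obtain ⟨x, hx⟩ := h.nonempty a
  exact ⟨x, hx, x, hx, h.le_refl i x⟩

theorem clsLe_trans {i j k : I} {hij : i ≤ j} {hjk : j ≤ k} {a : P.Cls N i} {b : P.Cls N j}
    {c : P.Cls N k} (hab : P.ClsLe hij a b) (hbc : P.ClsLe hjk b c) :
    P.ClsLe (hij.trans hjk) a c := by
  obtain ⟨x, hx, y, hy, hxy⟩ := hab
  obtain ⟨z, hz, hyz⟩ := (h.isSurj hbc).2 y hy
  exact ⟨x, hx, z, hz, h.le_trans _ _ _ _ _ hxy hyz⟩

theorem exists_upper {i j : I} (a : P.Cls N i) (b : P.Cls N j) :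
    ∃ (k : I) (hi : i ≤ k) (hj : j ≤ k) (c : P.Cls N k), P.ClsLe hi a c ∧ P.ClsLe hj b c := by
  obtain ⟨k, hi, hj, hk⟩ := h.join i j
  obtain ⟨c, hc, -⟩ := hk a b
  exact ⟨k, hi, hj, c, hc⟩

theorem ncard_le {i j : I} {hij : i ≤ j} {a : P.Cls N i} {b : P.Cls N j} (hab : P.ClsLe hij a b) :
    a.1.ncard ≤ b.1.ncard := by
  have : Nonempty (P.Elt N j) := (h.nonempty b).nonempty
  choose! f hf hle using (h.isSurj hab).2
  refine Set.ncard_le_ncard_of_injOn f hf (fun x hx x' hx' hxx' => ?_) (h.finite b)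
  exact h.eq_of_le hab (hf x hx) hx (hle x hx) hx' (hxx' ▸ hle x' hx')

theorem isBij_of_ncard_le {i j : I} {hij : i ≤ j} {a : P.Cls N i} {b : P.Cls N j}
    (hab : P.ClsLe hij a b) (hc : b.1.ncard ≤ a.1.ncard) : P.IsBij hij a b := by
  have hs := h.isSurj hab
  refine ⟨fun x hx => ?_, hs.1⟩
  obtain ⟨y, hy, hxy⟩ := hs.2 x hx
  refine ⟨y, ⟨hy, hxy⟩, fun y' ⟨hy', hxy'⟩ => ?_⟩
  refine Set.inj_on_of_surj_on_of_ncard_le (s := b.1) (t := a.1)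
    (fun y hy => (hs.1 y hy).choose) (fun y hy => (hs.1 y hy).choose_spec.1.1) (fun x hx => ?_)
    hc hy' hy ?_ (h.finite b)
  · obtain ⟨y, hy, hxy⟩ := hs.2 x hx
    exact ⟨y, hy, ((hs.1 y hy).choose_spec.2 x ⟨hx, hxy⟩).symm⟩
  · exact ((hs.1 y' hy').choose_spec.2 x ⟨hx, hxy'⟩).symm.trans
      ((hs.1 y hy).choose_spec.2 x ⟨hx, hxy⟩)

omit h in
theorem _root_.GradedSymbols.IsBij.clsLe (h : P.IsFiniteSystem N) {i j : I} {hij : i ≤ j}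
    {a : P.Cls N i} {b : P.Cls N j} (hab : P.IsBij hij a b) : P.ClsLe hij a b := by
  obtain ⟨x, hx⟩ := h.nonempty a
  obtain ⟨y, ⟨hy, hxy⟩, -⟩ := hab.1 x hx
  exact ⟨x, hx, y, hy, hxy⟩

theorem ncard_eq {i j : I} {hij : i ≤ j} {a : P.Cls N i} {b : P.Cls N j}
    (hab : P.IsBij hij a b) : a.1.ncard = b.1.ncard := by
  refine _root_.le_antisymm (h.ncard_le (hab.clsLe h)) ?_
  have : Nonempty (P.Elt N i) := (h.nonempty a).nonempty
  choose! f hf using fun y hy => (hab.2 y hy).exists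
  refine Set.ncard_le_ncard_of_injOn f (fun y hy => (hf y hy).1) (fun y hy y' hy' hyy' => ?_)
    (h.finite a)
  exact (hab.1 (f y) (hf y hy).1).unique ⟨hy, (hf y hy).2⟩ ⟨hy', hyy' ▸ (hf y' hy').2⟩

/-- Two comparable classes of one sort with equally many elements coincide, because each class is
the only copy of itself in its own sort. -/
theorem eq_of_clsLe {i : I} {a b : P.Cls N i} (hab : P.ClsLe le_rfl a b)
    (hc : b.1.ncard ≤ a.1.ncard) : a = b :=
  (h.copy le_rfl a).unique (h.isBij_of_ncard_le (h.clsLe_refl a) le_rfl)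
    (h.isBij_of_ncard_le hab hc)

theorem ncard_lt {i : I} {a b : P.Cls N i} (hab : P.ClsLe le_rfl a b) (hne : a ≠ b) :
    a.1.ncard < b.1.ncard :=
  lt_of_not_ge fun hc => hne (h.eq_of_clsLe hab hc)

end IsFiniteSystem

/-- `x` belongs to the copy of a class of the sort `S j`. -/
def IsCopyFrom (P : GradedSymbols L I) {N : Str.{u, v, w} L} {i : I} (j : I) (x : P.Elt N i) :
    Prop :=
  ∃ (hji : j ≤ i) (a : P.Cls N j), P.IsBij hji a (P.cls N x)

/-! ### Points of the inverse limit -/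

theorem Lim.clsLe_iff (h : P.IsFiniteSystem N) (ω : P.Lim N) {i j : I} {hij : i ≤ j}
    {a : P.Cls N i} {b : P.Cls N j} (hab : P.ClsLe hij a b) {x : P.Elt N i} (hx : x ∈ a.1) :
    ω.1 i a = x ↔ P.Le N hij x (ω.1 j b) := by
  have hle := ω.2.2 hij a b hab
  refine ⟨fun hωx => hωx ▸ hle, fun hxω => ?_⟩
  exact h.eq_of_le hab (ω.2.1 j b) (ω.2.1 i a) hle hx hxω

/-- A limit along an ultrafilter of families that are eventually coherent is a point of the inverse
limit. -/
theorem exists_lim_of_ultrafilter (h : P.IsFiniteSystem N) {X : Type*} (U : Ultrafilter X)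
    (p : X → ∀ i, P.Cls N i → P.Elt N i) (hmem : ∀ i a, ∀ᶠ c in U, p c i a ∈ a.1)
    (hle : ∀ {i j} (hij : i ≤ j) (a : P.Cls N i) (b : P.Cls N j), P.ClsLe hij a b →
      ∀ᶠ c in U, P.Le N hij (p c i a) (p c j b)) :
    ∃ ω : P.Lim N, ∀ i a, ∀ᶠ c in U, p c i a = ω.1 i a := by
  have key : ∀ i (a : P.Cls N i), ∃ x, ∀ᶠ c in U, p c i a = x := by
    intro i a
    have : ⋃₀ ((fun x => {c | p c i a = x}) '' a.1) ∈ U := by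
      filter_upwards [hmem i a] with c hc
      exact ⟨_, ⟨p c i a, hc, rfl⟩, rfl⟩
    obtain ⟨_, ⟨x, -, rfl⟩, hx⟩ :=
      (Ultrafilter.finite_sUnion_mem_iff ((h.finite a).image _)).1 this
    exact ⟨x, hx⟩
  choose ω hω using key
  refine ⟨⟨ω, fun i a => ?_, fun {i j} hij a b hab => ?_⟩, hω⟩
  · obtain ⟨c, hc, hc'⟩ := ((hmem i a).and (hω i a)).exists
    exact hc' ▸ hc
  · obtain ⟨c, hc, hca, hcb⟩ := ((hle hij a b hab).and ((hω i a).and (hω j b))).exists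
    rwa [← hca, ← hcb]

/-- The projections of the inverse limit to the classes are surjective. -/
theorem exists_lim_eq (h : P.IsFiniteSystem N) {i₀ : I} (a₀ : P.Cls N i₀) {x₀ : P.Elt N i₀}
    (hx₀ : x₀ ∈ a₀.1) : ∃ ω : P.Lim N, ω.1 i₀ a₀ = x₀ := by
  classical
  let X := Σ i, P.Cls N i
  let r : X → X → Prop := fun b c => ∃ hbc : b.1 ≤ c.1, P.ClsLe hbc b.2 c.2
  have hr : ∀ {b c d}, r b c → r c d → r b d := fun ⟨_, h₁⟩ ⟨_, h₂⟩ => ⟨_, h.clsLe_trans h₁ h₂⟩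
  -- The classes are directed upwards; the limit is taken along arbitrarily large classes.
  let F : Filter X := ⨅ b : X, Filter.principal {c | r b c}
  have : Nonempty X := ⟨⟨i₀, a₀⟩⟩
  have hF : F.NeBot := by
    refine Filter.iInf_neBot_of_directed (fun b c => ?_) fun b =>
      Filter.principal_neBot_iff.2 ⟨b, le_rfl, h.clsLe_refl b.2⟩
    obtain ⟨k, hi, hj, d, hd, hd'⟩ := h.exists_upper b.2 c.2
    refine ⟨⟨k, d⟩, Filter.principal_mono.2 fun e he => hr ⟨hi, hd⟩ he,
      Filter.principal_mono.2 fun e he => hr ⟨hj, hd'⟩ he⟩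
  have hev : ∀ b : X, ∀ᶠ c in Ultrafilter.of F, r b c := fun b =>
    Ultrafilter.of_le F (Filter.mem_iInf_of_mem b (Filter.mem_principal_self _))
  have hw : ∀ c : X, ∃ y ∈ c.2.1, ∀ hc : i₀ ≤ c.1, P.ClsLe hc a₀ c.2 → P.Le N hc x₀ y := by
    intro c
    by_cases hc : ∃ hc : i₀ ≤ c.1, P.ClsLe hc a₀ c.2
    · obtain ⟨hc, hle⟩ := hc
      obtain ⟨y, hy, hxy⟩ := (h.isSurj hle).2 x₀ hx₀
      exact ⟨y, hy, fun _ _ => hxy⟩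
    · obtain ⟨y, hy⟩ := h.nonempty c.2
      exact ⟨y, hy, fun h₁ h₂ => (hc ⟨h₁, h₂⟩).elim⟩
  choose y hy hxy using hw
  have hp : ∀ (c : X) i (a : P.Cls N i), ∃ x, ∀ hc : i ≤ c.1, P.ClsLe hc a c.2 →
      x ∈ a.1 ∧ P.Le N hc x (y c) := by
    intro c i a
    by_cases hc : ∃ hc : i ≤ c.1, P.ClsLe hc a c.2
    · obtain ⟨hc, hle⟩ := hc
      obtain ⟨x, hx, -⟩ := (h.isSurj hle).1 (y c) (hy c)
      exact ⟨x, fun _ _ => hx⟩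
    · obtain ⟨x, -⟩ := h.nonempty a
      exact ⟨x, fun h₁ h₂ => (hc ⟨h₁, h₂⟩).elim⟩
  choose p hp using hp
  have key := exists_lim_of_ultrafilter h (Ultrafilter.of F) p
  refine Exists.elim (key ?_ ?_) fun ω hω => ?_
  rotate_left 2
  · obtain ⟨c, hc, hle, hac⟩ := ((hω i₀ a₀).and (hev ⟨i₀, a₀⟩)).exists
    have := hp c i₀ a₀ hle hac
    exact ⟨ω, hc.symm.trans (h.eq_of_le hac (hy c) this.1 this.2 hx₀ (hxy c hle hac))⟩
  · intro i a
    filter_upwards [hev ⟨i, a⟩] with c ⟨hle, hac⟩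
    exact (hp c i a hle hac).1
  · intro i j hij a b hab
    filter_upwards [hev ⟨j, b⟩] with c ⟨hle, hbc⟩
    have hb := hp c j b hle hbc
    have ha := hp c i a (hij.trans hle) (h.clsLe_trans hab hbc)
    obtain ⟨x, ⟨hx, hxb⟩, -⟩ := (h.isSurj hab).1 _ hb.1
    rwa [h.eq_of_le (h.clsLe_trans hab hbc) (hy c) ha.1 ha.2 hx (h.le_trans _ _ _ _ _ hxb hb.2)]

/-- The preimage of a set under the projection of the inverse limit to the class `a`. -/
def cylSet {i : I} (a : P.Cls N i) (A : Set (P.Elt N i)) : Set (P.Lim N) := {ω | ω.1 i a ∈ A}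

variable (P N) in
/-- The cylinder sets of the inverse limit. -/
def cylinders : Set (Set (P.Lim N)) := {S | ∃ (i : I) (a : P.Cls N i) (A : Set _), S = cylSet a A}

/-- A decreasing sequence of non-empty cylinder sets has non-empty intersection. -/
theorem nonempty_iInter_cylinders (h : P.IsFiniteSystem N) {S : ℕ → Set (P.Lim N)}
    (hS : ∀ n, S n ∈ cylinders P N) (hanti : Antitone S) (hne : ∀ n, (S n).Nonempty) :
    (⋂ n, S n).Nonempty := by
  choose p hp using hne
  obtain ⟨ω, hω⟩ := exists_lim_of_ultrafilter h (Filter.hyperfilter ℕ) (fun n => (p n).1)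
    (fun i a => .of_forall fun n => (p n).2.1 i a)
    (fun hij a b hab => .of_forall fun n => (p n).2.2 hij a b hab)
  refine ⟨ω, Set.mem_iInter.2 fun n => ?_⟩
  obtain ⟨i, a, A, hA⟩ := hS n
  have hge : ∀ᶠ m in (Filter.hyperfilter ℕ : Filter ℕ), n ≤ m :=
    Nat.hyperfilter_le_atTop (Filter.eventually_ge_atTop n)
  obtain ⟨m, hm, hnm⟩ := ((hω i a).and hge).exists
  have hpm := hanti hnm (hp m)
  rw [hA] at hpm ⊢
  change ω.1 i a ∈ A
  rw [← hm]
  exact hpm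

theorem cylSet_lift (h : P.IsFiniteSystem N) {i j : I} {hij : i ≤ j} {a : P.Cls N i}
    {b : P.Cls N j} (hab : P.ClsLe hij a b) (A : Set (P.Elt N i)) :
    cylSet a A = cylSet b {y | ∃ x ∈ a.1 ∩ A, P.Le N hij x y} := by
  ext ω
  refine ⟨fun hω => ⟨_, ⟨ω.2.1 i a, hω⟩, ω.2.2 hij a b hab⟩, fun ⟨x, ⟨hx, hxA⟩, hxω⟩ => ?_⟩
  rw [← ω.clsLe_iff h hab hx] at hxω
  change ω.1 i a ∈ A
  rwa [hxω]

/-- Two cylinder sets are preimages of subsets of the same class. -/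
theorem exists_common_cls (h : P.IsFiniteSystem N) {S T : Set (P.Lim N)} (hS : S ∈ cylinders P N)
    (hT : T ∈ cylinders P N) :
    ∃ (k : I) (c : P.Cls N k) (A B : Set (P.Elt N k)), S = cylSet c A ∧ T = cylSet c B := by
  obtain ⟨i, a, A, rfl⟩ := hS
  obtain ⟨j, b, B, rfl⟩ := hT
  obtain ⟨k, hi, hj, c, hac, hbc⟩ := h.exists_upper a b
  exact ⟨k, c, _, _, cylSet_lift h hac A, cylSet_lift h hbc B⟩

theorem isSetRing_cylinders (h : P.IsFiniteSystem N) (hne : ∃ i, Nonempty (P.Elt N i)) :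
    IsSetRing (cylinders P N) where
  empty_mem := by
    obtain ⟨i, ⟨x⟩⟩ := hne
    exact ⟨i, P.cls N x, ∅, rfl⟩
  union_mem S T hS hT := by
    obtain ⟨k, c, A, B, rfl, rfl⟩ := exists_common_cls h hS hT
    exact ⟨k, c, A ∪ B, rfl⟩
  sdiff_mem S T hS hT := by
    obtain ⟨k, c, A, B, rfl, rfl⟩ := exists_common_cls h hS hT
    exact ⟨k, c, A \ B, rfl⟩

theorem univ_mem_cylinders (hne : ∃ i, Nonempty (P.Elt N i)) : Set.univ ∈ cylinders P N := by
  obtain ⟨i, ⟨x⟩⟩ := hne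
  exact ⟨i, P.cls N x, Set.univ, rfl⟩

variable (P N) in
theorem measurableSpace_eq :
    (inferInstance : MeasurableSpace (P.Lim N)) = .generateFrom (cylinders P N) := by
  refine le_antisymm ?_ ?_
  · refine iSup₂_le fun i a => ?_
    rintro _ ⟨A, -, rfl⟩
    exact .basic _ ⟨i, a, A, rfl⟩
  · refine MeasurableSpace.generateFrom_le ?_
    rintro _ ⟨i, a, A, rfl⟩
    have h : MeasurableSpace.comap (fun ω : P.Lim N => ω.1 i a) ⊤ ≤
        (inferInstance : MeasurableSpace (P.Lim N)) :=
      le_iSup₂ (f := fun (i : I) (a : P.Cls N i) =>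
        MeasurableSpace.comap (fun ω : P.Lim N => ω.1 i a) ⊤) i a
    exact h _ ⟨A, trivial, rfl⟩

end GradedSymbols

/-! ### The measure on the inverse limit -/

namespace GradedSymbols

variable {L : MSLanguage.{u, v}} {I : Type t} [PartialOrder I] {P : GradedSymbols L I}
variable {N : Str.{u, v, w} L} {μ : ∀ i, P.Elt N i → ℝ}

/-- The sum of the weights of those elements of the class `a` that lie in `A`. -/
noncomputable def weight (μ : ∀ i, P.Elt N i → ℝ) {i : I} (a : P.Cls N i) (A : Set (P.Elt N i)) :
    ℝ := ∑ᶠ x ∈ a.1 ∩ A, μ i x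

theorem weight_nonneg (h : P.IsProbabilitySystem N μ) {i : I} (a : P.Cls N i)
    (A : Set (P.Elt N i)) : 0 ≤ weight μ a A :=
  finsum_nonneg fun x => finsum_nonneg fun _ => (h.mem_unit i x).1

theorem weight_lift (h : P.IsProbabilitySystem N μ) {i j : I} {hij : i ≤ j} {a : P.Cls N i}
    {b : P.Cls N j} (hab : P.ClsLe hij a b) (A : Set (P.Elt N i)) :
    weight μ a A = weight μ b {y | ∃ x ∈ a.1 ∩ A, P.Le N hij x y} := by
  have hset : b.1 ∩ {y | ∃ x ∈ a.1 ∩ A, P.Le N hij x y} =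
      ⋃ x ∈ a.1 ∩ A, {y | y ∈ b.1 ∧ P.Le N hij x y} := by
    ext y
    simp only [Set.mem_inter_iff, Set.mem_ofPred_eq, Set.mem_iUnion, exists_prop]
    tauto
  have hb := h.toIsFiniteSystem.finite b
  have ha := h.toIsFiniteSystem.finite a
  rw [weight, weight, hset, finsum_mem_biUnion ?_ (ha.inter_of_left A)
    fun x _ => hb.subset fun y hy => hy.1]
  · exact finsum_mem_congr rfl fun x hx => h.sum_fibre hij a b hab x hx.1
  · intro x hx x' hx' hne
    refine Set.disjoint_left.2 fun y hy hy' => hne ?_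
    exact h.toIsFiniteSystem.eq_of_le hab hy.1 hx.1 hy.2 hx'.1 hy'.2

theorem inter_eq_of_cylSet_eq (h : P.IsFiniteSystem N) {i : I} {a : P.Cls N i}
    {A B : Set (P.Elt N i)} (hAB : cylSet a A = cylSet a B) : a.1 ∩ A = a.1 ∩ B := by
  ext x
  refine and_congr_right fun hx => ?_
  obtain ⟨ω, rfl⟩ := exists_lim_eq h a hx
  exact (Set.ext_iff.1 hAB ω)

/-- The content of a cylinder set does not depend on its presentation, because the projections of
the inverse limit are surjective. -/
theorem weight_eq (h : P.IsProbabilitySystem N μ) {i j : I} {a : P.Cls N i} {b : P.Cls N j}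
    {A : Set (P.Elt N i)} {B : Set (P.Elt N j)} (hAB : cylSet a A = cylSet b B) :
    weight μ a A = weight μ b B := by
  obtain ⟨k, hi, hj, c, hac, hbc⟩ := h.toIsFiniteSystem.exists_upper a b
  rw [cylSet_lift h.toIsFiniteSystem hac, cylSet_lift h.toIsFiniteSystem hbc] at hAB
  rw [weight_lift h hac, weight_lift h hbc, weight, weight,
    inter_eq_of_cylSet_eq h.toIsFiniteSystem hAB]

open Classical in
/-- The content of a cylinder set. -/
noncomputable def mass (μ : ∀ i, P.Elt N i → ℝ) (S : Set (P.Lim N)) : ENNReal :=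
  if hS : S ∈ cylinders P N then
    .ofReal (weight μ hS.choose_spec.choose hS.choose_spec.choose_spec.choose) else 0

theorem mass_cylSet (h : P.IsProbabilitySystem N μ) {i : I} (a : P.Cls N i)
    (A : Set (P.Elt N i)) : mass μ (cylSet a A) = .ofReal (weight μ a A) := by
  have hS : cylSet a A ∈ cylinders P N := ⟨i, a, A, rfl⟩
  rw [mass, dif_pos hS]
  congr 1
  exact (weight_eq h hS.choose_spec.choose_spec.choose_spec).symm

theorem mass_union (h : P.IsProbabilitySystem N μ) {S T : Set (P.Lim N)}
    (hS : S ∈ cylinders P N) (hT : T ∈ cylinders P N) (hST : Disjoint S T) :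
    mass μ (S ∪ T) = mass μ S + mass μ T := by
  obtain ⟨k, c, A, B, rfl, rfl⟩ := exists_common_cls h.toIsFiniteSystem hS hT
  have hU : cylSet c A ∪ cylSet c B = cylSet c (A ∪ B) := rfl
  have hc := h.toIsFiniteSystem.finite c
  rw [hU, mass_cylSet h, mass_cylSet h, mass_cylSet h,
    ← ENNReal.ofReal_add (weight_nonneg h _ _) (weight_nonneg h _ _)]
  congr 1
  rw [weight, Set.inter_union_distrib_left, finsum_mem_union ?_ (hc.inter_of_left _)
    (hc.inter_of_left _)]
  · rfl
  · refine Set.disjoint_left.2 fun x hx hx' => ?_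
    obtain ⟨ω, rfl⟩ := exists_lim_eq h.toIsFiniteSystem c hx.1
    exact Set.disjoint_left.1 hST hx.2 hx'.2

/-- The finitely additive content on the ring of cylinder sets. -/
noncomputable def content (h : P.IsProbabilitySystem N μ) (hne : ∃ i, Nonempty (P.Elt N i)) :
    AddContent ENNReal (cylinders P N) :=
  (isSetRing_cylinders h.toIsFiniteSystem hne).addContent_of_union (mass μ)
    (by
      obtain ⟨i, ⟨x⟩⟩ := hne
      have : (∅ : Set (P.Lim N)) = cylSet (P.cls N x) ∅ := rfl
      rw [this, mass_cylSet h, weight, Set.inter_empty, finsum_mem_empty, ENNReal.ofReal_zero])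
    (fun hS hT => mass_union h hS hT)

/-- By compactness, the content is continuous at `∅`, hence countably subadditive. -/
theorem content_isSigmaSubadditive (h : P.IsProbabilitySystem N μ)
    (hne : ∃ i, Nonempty (P.Elt N i)) : (content h hne).IsSigmaSubadditive := by
  have hring := isSetRing_cylinders h.toIsFiniteSystem hne
  have hval : ∀ S, content h hne S = mass μ S := fun S => rfl
  refine isSigmaSubadditive_of_addContent_iUnion_eq_tsum hring fun f hf hU hd =>
    addContent_iUnion_eq_sum_of_tendsto_zero hring _ ?_ ?_ hf hU hd
  · rintro _ ⟨i, a, A, rfl⟩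
    rw [hval, mass_cylSet h]
    exact ENNReal.ofReal_ne_top
  · intro S hS hanti hempty
    obtain ⟨n, hn⟩ : ∃ n, S n = ∅ := by
      by_contra! hcon
      have := nonempty_iInter_cylinders h.toIsFiniteSystem hS hanti hcon
      rw [hempty] at this
      exact Set.not_nonempty_empty this
    refine tendsto_const_nhds.congr' ((Filter.eventually_ge_atTop n).mono fun k hk => ?_)
    have : S k = ∅ := Set.subset_eq_empty (hanti hk) hn
    simp only [this, addContent_empty]

theorem cyl_eq_cylSet (h : P.IsFiniteSystem N) {i : I} {a : P.Cls N i} {x : P.Elt N i}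
    (hx : x ∈ a.1) : P.cyl x = cylSet a {x} := by
  rw [cyl, h.cls_eq hx]
  rfl

theorem measurableSet_cylSet {i : I} (a : P.Cls N i) (A : Set (P.Elt N i)) :
    MeasurableSet (cylSet a A) :=
  (measurableSpace_eq P N).ge _ (.basic _ ⟨i, a, A, rfl⟩)

theorem cylSet_eq_biUnion (h : P.IsFiniteSystem N) {i : I} (a : P.Cls N i)
    (A : Set (P.Elt N i)) [DecidablePred (· ∈ A)] :
    cylSet a A = ⋃ x ∈ (h.finite a).toFinset.filter (· ∈ A), P.cyl x := by
  ext ω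
  simp only [Set.mem_iUnion, Finset.mem_filter, Set.Finite.mem_toFinset, exists_prop]
  refine ⟨fun hω => ⟨ω.1 i a, ⟨ω.2.1 i a, hω⟩, ?_⟩, fun ⟨x, ⟨hx, hxA⟩, hω⟩ => ?_⟩
  · rw [cyl_eq_cylSet h (ω.2.1 i a)]
    exact rfl
  · rw [cyl_eq_cylSet h hx] at hω
    have : ω.1 i a = x := hω
    change ω.1 i a ∈ A
    rwa [this]

theorem disjoint_cyl (h : P.IsFiniteSystem N) {i : I} {a : P.Cls N i} {x y : P.Elt N i}
    (hx : x ∈ a.1) (hy : y ∈ a.1) (hxy : x ≠ y) : Disjoint (P.cyl x) (P.cyl y) := by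
  rw [cyl_eq_cylSet h hx, cyl_eq_cylSet h hy]
  refine Set.disjoint_left.2 fun ω hωx hωy => hxy ?_
  exact (Eq.symm hωx).trans hωy

theorem isLimitMeasure_unique (h : P.IsFiniteSystem N) (hne : ∃ i, Nonempty (P.Elt N i))
    {Q Q' : ProbabilityMeasure (P.Lim N)} (hQ : P.IsLimitMeasure μ Q)
    (hQ' : P.IsLimitMeasure μ Q') : Q' = Q := by
  classical
  refine Subtype.ext ?_
  change (Q' : Measure (P.Lim N)) = Q
  refine ext_of_generate_finite (cylinders P N) (measurableSpace_eq P N) ?_ ?_ ?_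
  · exact fun S hS T hT _ => (isSetRing_cylinders h hne).inter_mem hS hT
  · rintro _ ⟨i, a, A, rfl⟩
    have hd : ((((h.finite a).toFinset.filter (· ∈ A) : Finset _) : Set _)).PairwiseDisjoint
        (P.cyl (N := N) (i := i)) := by
      intro x hx y hy hxy
      rw [Finset.mem_coe, Finset.mem_filter, Set.Finite.mem_toFinset] at hx hy
      exact disjoint_cyl h hx.1 hy.1 hxy
    rw [cylSet_eq_biUnion h, measure_biUnion_finset hd fun x _ => P.measurableSet_cyl x,
      measure_biUnion_finset hd fun x _ => P.measurableSet_cyl x]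
    refine Finset.sum_congr rfl fun x _ => ?_
    have := (hQ' i x).trans (hQ i x).symm
    exact (measureReal_eq_measureReal_iff).1 this
  · exact (Q'.2.measure_univ).trans Q.2.measure_univ.symm

theorem exists_isLimitMeasure (h : P.IsProbabilitySystem N μ)
    (hne : ∃ i, Nonempty (P.Elt N i)) :
    ∃ Q : ProbabilityMeasure (P.Lim N), P.IsLimitMeasure μ Q := by
  have hring := isSetRing_cylinders h.toIsFiniteSystem hne
  let Q := (content h hne).measure hring.isSetSemiring (measurableSpace_eq P N).le
    (content_isSigmaSubadditive h hne)
  have hQ : ∀ {i} (a : P.Cls N i) A, Q (cylSet a A) = .ofReal (weight μ a A) := fun {i} a A => by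
    rw [← mass_cylSet h]
    exact (content h hne).measure_eq hring.isSetSemiring (measurableSpace_eq P N)
      (content_isSigmaSubadditive h hne) ⟨i, a, A, rfl⟩
  have hprob : IsProbabilityMeasure Q := by
    obtain ⟨i, ⟨x⟩⟩ := hne
    have hu : (Set.univ : Set (P.Lim N)) = cylSet (P.cls N x) Set.univ := rfl
    refine ⟨?_⟩
    rw [hu, hQ, weight, Set.inter_univ, h.sum_one, ENNReal.ofReal_one]
  refine ⟨⟨Q, hprob⟩, fun i x => ?_⟩
  have hx := h.toIsFiniteSystem.mem_cls x
  change Q.real (P.cyl x) = _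
  rw [cyl_eq_cylSet h.toIsFiniteSystem hx, Measure.real, hQ,
    ENNReal.toReal_ofReal (weight_nonneg h _ _), weight,
    Set.inter_eq_self_of_subset_right (Set.singleton_subset_iff.2 hx), finsum_mem_singleton]

end GradedSymbols

/-! ### Conditional independence of classes -/

theorem indicatorConstLp_biUnion_finset {α ι : Type*} {mα : MeasurableSpace α} {ρ : Measure α}
    [IsFiniteMeasure ρ] (s : Finset ι) {S : ι → Set α} (hS : ∀ i, MeasurableSet (S i))
    (hd : (s : Set ι).PairwiseDisjoint S) :
    indicatorConstLp 2 (s.measurableSet_biUnion fun i _ => hS i) (measure_ne_top ρ _) (1 : ℝ) =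
      ∑ i ∈ s, indicatorConstLp 2 (hS i) (measure_ne_top ρ _) (1 : ℝ) := by
  classical
  induction s using Finset.induction_on with
  | empty => simp
  | insert i s hi ih =>
    rw [Finset.sum_insert hi, ← ih (hd.subset (by simp)), ← indicatorConstLp_disjoint_union]
    · congr 1
      simp
    · refine Set.disjoint_iUnion₂_right.2 fun j hj => hd (by simp) (by simp [hj]) ?_
      rintro rfl
      exact hi hj

namespace GradedSymbols

variable {L : MSLanguage.{u, v}} {I : Type t} [PartialOrder I] {P : GradedSymbols L I}
variable {N : Str.{u, v, w} L} {μ : ∀ i, P.Elt N i → ℝ} {Q : ProbabilityMeasure (P.Lim N)}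

open Classical in
theorem indicator_cylSet_eq_sum (h : P.IsFiniteSystem N) {i : I} (a : P.Cls N i)
    (A : Set (P.Elt N i)) :
    indicatorConstLp 2 (measurableSet_cylSet a A)
      (measure_ne_top (Q : Measure (P.Lim N)) _) (1 : ℝ) =
      ∑ x ∈ (h.finite a).toFinset.filter (· ∈ A), P.vec Q x := by
  refine Eq.trans ?_ (indicatorConstLp_biUnion_finset (ρ := (Q : Measure (P.Lim N)))
    ((h.finite a).toFinset.filter (· ∈ A)) (S := fun x => P.cyl x) P.measurableSet_cyl ?_)
  · congr 1
    exact cylSet_eq_biUnion h a A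
  · intro x hx y hy hxy
    rw [Finset.mem_coe, Finset.mem_filter, Set.Finite.mem_toFinset] at hx hy
    exact disjoint_cyl h hx.1 hy.1 hxy

theorem cyl_eq_cylSet_le (h : P.IsFiniteSystem N) {i j : I} {hij : i ≤ j} {a : P.Cls N i}
    {b : P.Cls N j} (hab : P.ClsLe hij a b) {x : P.Elt N i} (hx : x ∈ a.1) :
    P.cyl x = cylSet b {y | P.Le N hij x y} := by
  rw [cyl_eq_cylSet h hx, cylSet_lift h hab]
  congr 1
  ext y
  exact ⟨fun ⟨x', hx', hle⟩ => by rw [← hx'.2]; exact hle, fun hle => ⟨x, ⟨hx, rfl⟩, hle⟩⟩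

open Classical in
theorem vec_eq_sum (h : P.IsFiniteSystem N) {i j : I} {hij : i ≤ j} {a : P.Cls N i}
    {b : P.Cls N j} (hab : P.ClsLe hij a b) {x : P.Elt N i} (hx : x ∈ a.1) :
    P.vec Q x = ∑ y ∈ (h.finite b).toFinset.filter (P.Le N hij x ·), P.vec Q y := by
  have := indicator_cylSet_eq_sum (Q := Q) h b {y | P.Le N hij x y}
  simp only [← cyl_eq_cylSet_le h hab hx] at this
  exact this

/-- The finite-dimensional subspace of `L²` that is spanned by the class `a`. -/
noncomputable def clsSpan (Q : ProbabilityMeasure (P.Lim N)) {i : I} (a : P.Cls N i) :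
    Submodule ℝ (P.L2 Q) :=
  Submodule.span ℝ (P.vec Q '' a.1)

theorem vec_mem_clsSpan {i : I} {a : P.Cls N i} {x : P.Elt N i} (hx : x ∈ a.1) :
    P.vec Q x ∈ clsSpan Q a := Submodule.subset_span ⟨x, hx, rfl⟩

theorem clsSpan_mono (h : P.IsFiniteSystem N) {i j : I} {hij : i ≤ j} {a : P.Cls N i}
    {b : P.Cls N j} (hab : P.ClsLe hij a b) : clsSpan Q a ≤ clsSpan Q b := by
  classical
  refine Submodule.span_le.2 ?_
  rintro _ ⟨x, hx, rfl⟩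
  rw [SetLike.mem_coe, vec_eq_sum h hab hx]
  refine Submodule.sum_mem _ fun y hy => vec_mem_clsSpan ?_
  rw [Finset.mem_filter, Set.Finite.mem_toFinset] at hy
  exact hy.1

theorem finiteDimensional_clsSpan (h : P.IsFiniteSystem N) {i : I} (a : P.Cls N i) :
    FiniteDimensional ℝ (clsSpan Q a) :=
  FiniteDimensional.span_of_finite ℝ ((h.finite a).image _)

theorem inner_vec_vec {i j : I} (x : P.Elt N i) (y : P.Elt N j) :
    inner ℝ (P.vec Q x) (P.vec Q y) = (Q : Measure (P.Lim N)).real (P.cyl x ∩ P.cyl y) :=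
  L2.real_inner_indicatorConstLp_one_indicatorConstLp_one _ _ _ _

theorem inner_vec_self (hQ : P.IsLimitMeasure μ Q) {i : I} (x : P.Elt N i) :
    inner ℝ (P.vec Q x) (P.vec Q x) = μ i x := by
  rw [inner_vec_vec, Set.inter_self]
  exact hQ i x

theorem inner_vec_of_ne (h : P.IsFiniteSystem N) {i : I} {a : P.Cls N i} {x y : P.Elt N i}
    (hx : x ∈ a.1) (hy : y ∈ a.1) (hxy : x ≠ y) : inner ℝ (P.vec Q x) (P.vec Q y) = 0 := by
  rw [inner_vec_vec, (disjoint_cyl h hx hy hxy).inter_eq, measureReal_empty]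

theorem inner_vec_of_le (h : P.IsFiniteSystem N) (hQ : P.IsLimitMeasure μ Q) {i j : I}
    {hij : i ≤ j} {a : P.Cls N i} {b : P.Cls N j} (hab : P.ClsLe hij a b) {x : P.Elt N i}
    {y : P.Elt N j} (hx : x ∈ a.1) (hy : y ∈ b.1) [Decidable (P.Le N hij x y)] :
    inner ℝ (P.vec Q x) (P.vec Q y) = if P.Le N hij x y then μ j y else 0 := by
  classical
  rw [vec_eq_sum h hab hx, sum_inner]
  split_ifs with hle
  · rw [Finset.sum_eq_single_of_mem y (by simp [hy, hle]), inner_vec_self hQ]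
    intro y' hy' hne
    rw [Finset.mem_filter, Set.Finite.mem_toFinset] at hy'
    exact inner_vec_of_ne h hy'.1 hy hne
  · refine Finset.sum_eq_zero fun y' hy' => ?_
    rw [Finset.mem_filter, Set.Finite.mem_toFinset] at hy'
    refine inner_vec_of_ne h hy'.1 hy ?_
    rintro rfl
    exact hle hy'.2

theorem measureReal_cylSet (h : P.IsFiniteSystem N) (hQ : P.IsLimitMeasure μ Q) {i : I}
    (a : P.Cls N i) (A : Set (P.Elt N i)) :
    (Q : Measure (P.Lim N)).real (cylSet a A) = weight μ a A := by
  classical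
  rw [cylSet_eq_biUnion h, measureReal_biUnion_finset _ fun x _ => P.measurableSet_cyl x]
  · have hA : a.1 ∩ A = ((h.finite a).toFinset.filter (· ∈ A) : Set _) := by
      ext x
      simp
    rw [weight, hA, finsum_mem_coe_finset]
    exact Finset.sum_congr rfl fun x _ => hQ i x
  · intro x hx y hy hxy
    rw [Finset.mem_coe, Finset.mem_filter, Set.Finite.mem_toFinset] at hx hy
    exact disjoint_cyl h hx.1 hy.1 hxy

variable (h : P.IsTwoRegular N μ) (hQ : P.IsLimitMeasure μ Q)
include h hQ

theorem inner_vec_le {i : I} {a b m : P.Cls N i} (hm : P.IsMeet a b m) {x y z : P.Elt N i}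
    (hx : x ∈ a.1) (hy : y ∈ b.1) (hz : z ∈ m.1) (hzx : P.Le N le_rfl z x)
    (hzy : P.Le N le_rfl z y) :
    inner ℝ (P.vec Q x) (P.vec Q y) ≤ μ i x * μ i y / μ i z := by
  have hf := h.toIsFiniteSystem
  obtain ⟨k, hi, hi', hk⟩ := hf.join i i
  obtain ⟨c, hc⟩ := hk a b
  rw [inner_vec_vec, cyl_eq_cylSet_le hf hc.1.1 hx, cyl_eq_cylSet_le hf hc.1.2 hy]
  have hU : cylSet c {w | P.Le N hi x w} ∩ cylSet c {w | P.Le N hi' y w} =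
    cylSet c {w | P.Le N hi x w ∧ P.Le N hi' y w} := rfl
  rw [hU, measureReal_cylSet hf hQ]
  change ∑ᶠ w ∈ {w | w ∈ c.1 ∧ P.Le N hi x w ∧ P.Le N hi y w}, μ k w ≤ _
  by_cases hne : {w | w ∈ c.1 ∧ P.Le N hi x w ∧ P.Le N hi y w}.Nonempty
  · exact (h.two_regular hi hk a b m c hm hc x hx y hy hne z hz hzx hzy).le
  · rw [Set.not_nonempty_iff_eq_empty.1 hne, finsum_mem_empty]
    exact div_nonneg (mul_nonneg (h.mem_unit i x).1 (h.mem_unit i y).1) (h.mem_unit i z).1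

/-- The classes `a` and `b` are independent over their meet. `2`-regularity gives an upper bound for
the inner products of two elements over `z`, including the case of an empty join; both sides have
the same sum over all `x` above `z`, so the bound is attained. -/
theorem inner_vec_eq {i : I} {a b m : P.Cls N i} (hm : P.IsMeet a b m) {x y z : P.Elt N i}
    (hx : x ∈ a.1) (hy : y ∈ b.1) (hz : z ∈ m.1) (hzx : P.Le N le_rfl z x)
    (hzy : P.Le N le_rfl z y) :
    inner ℝ (P.vec Q x) (P.vec Q y) = μ i x * μ i y / μ i z := by
  classical
  have hf := h.toIsFiniteSystem
  have hle := fun {x'} (hx' : x' ∈ a.1) (hzx' : P.Le N le_rfl z x') =>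
    inner_vec_le h hQ hm hx' hy hz hzx' hzy
  have hzy' : inner ℝ (P.vec Q z) (P.vec Q y) = μ i y := by
    rw [inner_vec_of_le hf hQ hm.1.2 hz hy, if_pos hzy]
  by_cases hμ : μ i z = 0
  · refine le_antisymm (hle hx hzx) ?_
    rw [hμ, div_zero, inner_vec_vec]
    exact measureReal_nonneg
  have hzsum : μ i z = ∑ x' ∈ (hf.finite a).toFinset.filter (P.Le N le_rfl z ·), μ i x' := by
    have := inner_vec_self hQ z
    conv_lhs at this => arg 2; rw [vec_eq_sum hf hm.1.1 hz]
    rw [sum_inner] at this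
    rw [← this]
    refine Finset.sum_congr rfl fun x' hx' => ?_
    rw [Finset.mem_filter, Set.Finite.mem_toFinset] at hx'
    rw [real_inner_comm, inner_vec_of_le hf hQ hm.1.1 hz hx'.1, if_pos hx'.2]
  have hsum : ∑ x' ∈ (hf.finite a).toFinset.filter (P.Le N le_rfl z ·),
      inner ℝ (P.vec Q x') (P.vec Q y) =
      ∑ x' ∈ (hf.finite a).toFinset.filter (P.Le N le_rfl z ·), μ i x' * μ i y / μ i z := by
    rw [← sum_inner, ← vec_eq_sum hf hm.1.1 hz, hzy', ← Finset.sum_div, ← Finset.sum_mul, ← hzsum,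
      mul_div_cancel_left₀ _ hμ]
  refine (Finset.sum_eq_sum_iff_of_le fun x' hx' => ?_).1 hsum x (by simp [hx, hzx])
  rw [Finset.mem_filter, Set.Finite.mem_toFinset] at hx'
  exact hle hx'.1 hx'.2

/-- Modulo the orthogonal complement of the span of `a`, the span of `b` is contained in the span of
the meet of `a` and `b`. -/
theorem exists_sub_orthogonal {i : I} {a b m : P.Cls N i} (hm : P.IsMeet a b m) {ξ : P.L2 Q}
    (hξ : ξ ∈ clsSpan Q b) : ∃ ζ ∈ clsSpan Q m, ξ - ζ ∈ (clsSpan Q a)ᗮ := by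
  classical
  have hf := h.toIsFiniteSystem
  induction hξ using Submodule.span_induction with
  | zero => exact ⟨0, Submodule.zero_mem _, by simp⟩
  | add ξ ξ' _ _ h₁ h₂ =>
    obtain ⟨ζ, hζ, hζ'⟩ := h₁
    obtain ⟨θ, hθ, hθ'⟩ := h₂
    exact ⟨ζ + θ, add_mem hζ hθ, by rw [add_sub_add_comm]; exact add_mem hζ' hθ'⟩
  | smul r ξ _ h₁ =>
    obtain ⟨ζ, hζ, hζ'⟩ := h₁
    exact ⟨r • ζ, Submodule.smul_mem _ r hζ, by rw [← smul_sub]; exact Submodule.smul_mem _ r hζ'⟩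
  | mem ξ hξ =>
    obtain ⟨y, hy, rfl⟩ := hξ
    obtain ⟨z, ⟨hz, hzy⟩, -⟩ := (hf.isSurj hm.1.2).1 y hy
    -- The conditional expectation of `y` with respect to `a` is a multiple of `z`.
    refine ⟨(μ i y / μ i z) • P.vec Q z, Submodule.smul_mem _ _ (vec_mem_clsSpan hz), ?_⟩
    refine (Submodule.mem_orthogonal _ _).2 fun θ hθ => ?_
    induction hθ using Submodule.span_induction with
    | zero => simp
    | add θ θ' _ _ h₁ h₂ => rw [inner_add_left, h₁, h₂, add_zero]
    | smul r θ _ h₁ => rw [inner_smul_left, h₁, mul_zero]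
    | mem θ hθ =>
      obtain ⟨x, hx, rfl⟩ := hθ
      rw [inner_sub_right, inner_smul_right, real_inner_comm (P.vec Q z),
        inner_vec_of_le hf hQ hm.1.1 hz hx]
      split_ifs with hzx
      · rw [inner_vec_eq h hQ hm hx hy hz hzx hzy]
        ring
      · rw [mul_zero, sub_zero, inner_vec_vec]
        have : P.cyl x ∩ P.cyl y = ∅ := by
          rw [Set.eq_empty_iff_forall_notMem]
          rintro ω ⟨hωx, hωy⟩
          rw [cyl_eq_cylSet hf hx] at hωx
          rw [cyl_eq_cylSet hf hy] at hωy
          have h₁ := (ω.clsLe_iff hf hm.1.2 hz).2 (by rw [show ω.1 i b = y from hωy]; exact hzy)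
          have h₂ := (ω.clsLe_iff hf hm.1.1 hz).1 h₁
          rw [show ω.1 i a = x from hωx] at h₂
          exact hzx h₂
        rw [this, measureReal_empty]

theorem clsSpan_le_of_isMeet {i : I} {a b m : P.Cls N i} (hm : P.IsMeet a b m)
    (hab : clsSpan Q a ≤ clsSpan Q b) : clsSpan Q a ≤ clsSpan Q m := by
  intro ξ hξ
  obtain ⟨ζ, hζ, hζ'⟩ := exists_sub_orthogonal h hQ hm (hab hξ)
  have hmem : ξ - ζ ∈ clsSpan Q a :=
    sub_mem hξ (clsSpan_mono h.toIsFiniteSystem hm.1.1 hζ)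
  have := inner_self_eq_zero.1 ((Submodule.mem_orthogonal _ _).1 hζ' _ hmem)
  rwa [sub_eq_zero.1 this]

end GradedSymbols

/-! ### The vectors `P_{W[x]^⊥} x` -/

namespace GradedSymbols

variable {L : MSLanguage.{u, v}} {I : Type t} [PartialOrder I] {P : GradedSymbols L I}
variable {N : Str.{u, v, w} L} {μ : ∀ i, P.Elt N i → ℝ} {Q : ProbabilityMeasure (P.Lim N)}

theorem lower_le_iff {i : I} {x : P.Elt N i} {K : Submodule ℝ (P.L2 Q)} :
    P.lower Q x ≤ K ↔
      ∀ b : P.Cls N i, P.ClsLe le_rfl b (P.cls N x) → b ≠ P.cls N x → clsSpan Q b ≤ K := by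
  refine ⟨fun hK b hb hne => ?_, fun hK => Submodule.span_le.2 ?_⟩
  · refine (Submodule.span_mono ?_).trans hK
    rintro _ ⟨y, hy, rfl⟩
    exact ⟨b, hb, hne, y, hy, rfl⟩
  · rintro _ ⟨b, hb, hne, y, hy, rfl⟩
    exact hK b hb hne (vec_mem_clsSpan hy)

theorem lower_le (h : P.IsFiniteSystem N) {i : I} (x : P.Elt N i) :
    P.lower Q x ≤ clsSpan Q (P.cls N x) :=
  lower_le_iff.2 fun _ hb _ => clsSpan_mono h hb

theorem clsSpan_le_lower {i : I} {x : P.Elt N i} {b : P.Cls N i}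
    (hb : P.ClsLe le_rfl b (P.cls N x)) (hne : b ≠ P.cls N x) : clsSpan Q b ≤ P.lower Q x :=
  lower_le_iff.1 le_rfl b hb hne

theorem finiteDimensional_lower (h : P.IsFiniteSystem N) {i : I} (x : P.Elt N i) :
    FiniteDimensional ℝ (P.lower Q x) := by
  have := finiteDimensional_clsSpan (Q := Q) h (P.cls N x)
  exact Submodule.finiteDimensional_of_le (lower_le h x)

theorem resid_mem_orthogonal {i : I} (x : P.Elt N i) : P.resid Q x ∈ (P.lower Q x)ᗮ :=
  @Submodule.starProjection_apply_mem _ _ _ _ _ (P.lower Q x)ᗮ _ _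

theorem vec_sub_resid_mem (h : P.IsFiniteSystem N) {i : I} (x : P.Elt N i) :
    P.vec Q x - P.resid Q x ∈ P.lower Q x := by
  have := finiteDimensional_lower (Q := Q) h x
  rw [resid, Submodule.starProjection_orthogonal_val, sub_sub_cancel]
  exact Submodule.starProjection_apply_mem _ _

theorem resid_mem_clsSpan (h : P.IsFiniteSystem N) {i : I} (x : P.Elt N i) :
    P.resid Q x ∈ clsSpan Q (P.cls N x) := by
  have := sub_mem (vec_mem_clsSpan (Q := Q) (h.mem_cls x)) (lower_le h x (vec_sub_resid_mem h x))
  rwa [sub_sub_cancel] at this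

theorem vec_eq_of_isBij (h : P.IsFiniteSystem N) {i j : I} {hij : i ≤ j} {a : P.Cls N i}
    {b : P.Cls N j} (hab : P.IsBij hij a b) {x : P.Elt N i} {y : P.Elt N j} (hx : x ∈ a.1)
    (hy : y ∈ b.1) (hxy : P.Le N hij x y) : P.vec Q x = P.vec Q y := by
  classical
  rw [vec_eq_sum h (hab.clsLe h) hx, Finset.sum_eq_single_of_mem y (by simp [hy, hxy])]
  intro y' hy' hne
  rw [Finset.mem_filter, Set.Finite.mem_toFinset] at hy'
  exact (hne ((hab.1 x hx).unique hy' ⟨hy, hxy⟩)).elim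

theorem clsSpan_eq_of_isBij (h : P.IsFiniteSystem N) {i j : I} {hij : i ≤ j} {a : P.Cls N i}
    {b : P.Cls N j} (hab : P.IsBij hij a b) : clsSpan Q a = clsSpan Q b := by
  refine le_antisymm (clsSpan_mono h (hab.clsLe h)) (Submodule.span_le.2 ?_)
  rintro _ ⟨y, hy, rfl⟩
  obtain ⟨x, ⟨hx, hxy⟩, -⟩ := hab.2 y hy
  rw [← vec_eq_of_isBij h hab hx hy hxy]
  exact vec_mem_clsSpan hx

section TwoRegular

variable (h : P.IsTwoRegular N μ) (hQ : P.IsLimitMeasure μ Q)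
include h hQ

/-- The spaces `W[x]` computed in the sort of `x` and in the sort of a copy `y` of `x` agree.
Copying need not preserve the order of classes, so that two classes are compared through their
meet with the largest class in question. -/
theorem lower_eq_of_isBij {i j : I} {hij : i ≤ j} {x : P.Elt N i} {y : P.Elt N j}
    (hxy : P.IsBij hij (P.cls N x) (P.cls N y)) : P.lower Q x = P.lower Q y := by
  have hf := h.toIsFiniteSystem
  have hspan := clsSpan_eq_of_isBij (Q := Q) hf hxy
  have hcard := hf.ncard_eq hxy
  refine le_antisymm (lower_le_iff.2 fun b hb hne => ?_) (lower_le_iff.2 fun c hc hne => ?_)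
  · obtain ⟨b', hb', -⟩ := hf.copy hij b
    obtain ⟨m, hm, -⟩ := hf.meet b' (P.cls N y)
    have hbb' := clsSpan_eq_of_isBij (Q := Q) hf hb'
    have hle : clsSpan Q b' ≤ clsSpan Q (P.cls N y) := by
      rw [← hbb', ← hspan]
      exact clsSpan_mono hf hb
    rw [hbb']
    refine (clsSpan_le_of_isMeet h hQ hm hle).trans (clsSpan_le_lower hm.1.2 ?_)
    rintro rfl
    have h₁ := hf.ncard_le hm.1.1
    have h₂ := hf.ncard_lt hb hne
    have h₃ := hf.ncard_eq hb'
    omega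
  · obtain ⟨c', hc'⟩ := hf.copy_below hij _ _ hxy c hc
    obtain ⟨m, hm, -⟩ := hf.meet c' (P.cls N x)
    have hcc' := clsSpan_eq_of_isBij (Q := Q) hf hc'
    have hle : clsSpan Q c' ≤ clsSpan Q (P.cls N x) := by
      rw [hcc', hspan]
      exact clsSpan_mono hf hc
    rw [← hcc']
    refine (clsSpan_le_of_isMeet h hQ hm hle).trans (clsSpan_le_lower hm.1.2 ?_)
    rintro rfl
    have h₁ := hf.ncard_le hm.1.1
    have h₂ := hf.ncard_lt hc hne
    have h₃ := hf.ncard_eq hc'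
    omega

theorem resid_eq_of_isBij {i j : I} {hij : i ≤ j} {x : P.Elt N i} {y : P.Elt N j}
    (hb : P.IsBij hij (P.cls N x) (P.cls N y)) (hxy : P.Le N hij x y) :
    P.resid Q x = P.resid Q y := by
  have hf := h.toIsFiniteSystem
  have hl := lower_eq_of_isBij h hQ hb
  have hv := vec_eq_of_isBij (Q := Q) hf hb (hf.mem_cls x) (hf.mem_cls y) hxy
  rw [resid, resid, hv]
  simp only [hl]

/-- The projection of `x` is orthogonal to all classes that do not lie above `[x]`. -/
theorem resid_mem_orthogonal_clsSpan {i : I} {x : P.Elt N i} {d : P.Cls N i}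
    (hd : ¬ P.ClsLe le_rfl (P.cls N x) d) : P.resid Q x ∈ (clsSpan Q d)ᗮ := by
  have hf := h.toIsFiniteSystem
  obtain ⟨m, hm, -⟩ := hf.meet (P.cls N x) d
  refine (Submodule.mem_orthogonal _ _).2 fun ξ hξ => ?_
  obtain ⟨ζ, hζ, hζ'⟩ := exists_sub_orthogonal h hQ hm hξ
  have hne : m ≠ P.cls N x := by
    rintro rfl
    exact hd hm.1.2
  have h₁ := (Submodule.mem_orthogonal _ _).1 (resid_mem_orthogonal (Q := Q) x) ζ
    (clsSpan_le_lower hm.1.1 hne hζ)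
  have h₂ := (Submodule.mem_orthogonal' _ _).1 hζ' _ (resid_mem_clsSpan hf x)
  rw [inner_sub_left, h₁, sub_zero] at h₂
  exact h₂

theorem inner_resid_resid_of_ne {i : I} {x y : P.Elt N i} (hne : P.cls N x ≠ P.cls N y) :
    inner ℝ (P.resid Q x) (P.resid Q y) = 0 := by
  have hf := h.toIsFiniteSystem
  by_cases hxy : P.ClsLe le_rfl (P.cls N x) (P.cls N y)
  · have hyx : ¬ P.ClsLe le_rfl (P.cls N y) (P.cls N x) := fun hyx =>
      hne (hf.eq_of_clsLe hxy (hf.ncard_le hyx))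
    exact (Submodule.mem_orthogonal _ _).1 (resid_mem_orthogonal_clsSpan h hQ hyx) _
      (resid_mem_clsSpan hf x)
  · exact (Submodule.mem_orthogonal' _ _).1 (resid_mem_orthogonal_clsSpan h hQ hxy) _
      (resid_mem_clsSpan hf y)

omit hQ in
theorem inner_resid_resid_of_eq {i : I} {x y : P.Elt N i} (heq : P.cls N x = P.cls N y) :
    inner ℝ (P.resid Q x) (P.resid Q y) = inner ℝ (P.resid Q x) (P.vec Q y) := by
  have hl : P.lower Q x = P.lower Q y := by rw [lower, lower, heq]
  have := (Submodule.mem_orthogonal' _ _).1 (resid_mem_orthogonal (Q := Q) x) _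
    (hl ▸ vec_sub_resid_mem h.toIsFiniteSystem y)
  rw [inner_sub_right] at this
  linarith

theorem resid_mem_orthogonal_of_not_isCopyFrom {i j : I} (hji : j ≤ i) {x : P.Elt N i}
    (hx : ¬ P.IsCopyFrom j x) (a : P.Cls N j) : P.resid Q x ∈ (clsSpan Q a)ᗮ := by
  have hf := h.toIsFiniteSystem
  obtain ⟨b, hab, -⟩ := hf.copy hji a
  rw [clsSpan_eq_of_isBij hf hab]
  refine resid_mem_orthogonal_clsSpan h hQ fun hxb => hx ?_
  obtain ⟨a', ha'⟩ := hf.copy_below hji a b hab _ hxb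
  exact ⟨hji, a', ha'⟩

end TwoRegular

/-- The classes span a dense subspace of `L²`. -/
theorem topologicalClosure_iSup_clsSpan (h : P.IsFiniteSystem N)
    (hne : ∃ i, Nonempty (P.Elt N i)) :
    (⨆ (i : I) (a : P.Cls N i), clsSpan Q a).topologicalClosure = ⊤ := by
  classical
  rw [Submodule.topologicalClosure_eq_top_iff, Submodule.eq_bot_iff]
  intro f hf
  have hcyl : ∀ S (hS : S ∈ cylinders P N), ∫ ω in S, f ω ∂(Q : Measure (P.Lim N)) = 0 := by
    rintro _ ⟨i, a, A, rfl⟩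
    rw [← L2.inner_indicatorConstLp_one (𝕜 := ℝ) (measurableSet_cylSet a A) (measure_ne_top _ _),
      indicator_cylSet_eq_sum h, sum_inner]
    refine Finset.sum_eq_zero fun x hx => (Submodule.mem_orthogonal _ _).1 hf _ ?_
    rw [Finset.mem_filter, Set.Finite.mem_toFinset] at hx
    exact Submodule.mem_iSup_of_mem i (Submodule.mem_iSup_of_mem a (vec_mem_clsSpan hx.1))
  have hint : Integrable f (Q : Measure (P.Lim N)) := (Lp.memLp f).integrable one_le_two
  have hall : ∀ S, MeasurableSet S → ∫ ω in S, f ω ∂(Q : Measure (P.Lim N)) = 0 := by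
    intro S hS
    induction S, hS using MeasurableSpace.induction_on_inter (measurableSpace_eq P N)
      (fun S hS T hT _ => (isSetRing_cylinders h hne).inter_mem hS hT) with
    | empty => simp
    | basic S hS => exact hcyl S hS
    | compl S hS ih =>
      have := integral_add_compl hS hint
      rw [ih, zero_add] at this
      rw [this, ← setIntegral_univ]
      exact hcyl _ (univ_mem_cylinders hne)
    | iUnion S hd hS ih =>
      rw [integral_iUnion hS hd hint.integrableOn]
      simp [ih]
  have := Lp.ae_eq_zero_of_forall_setIntegral_eq_zero f (by norm_num) (by norm_num)
    (fun S _ _ => hint.integrableOn) fun S hS _ => hall S hS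
  exact (Lp.eq_zero_iff_ae_eq_zero).2 this

end GradedSymbols

/-! ### The orthogonal decomposition -/

/-- An increasing cofinal sequence without repetitions, finite or infinite, presented by the set `J`
of its members. -/
structure CofinalChain (I : Type t) [PartialOrder I] where
  J : Set I
  /-- The preceding member of the sequence; there is none before the first one. -/
  prev : I → Option I
  /-- A function that increases along the sequence. -/
  rank : I → ℕ
  cofinal : ∀ i, ∃ j ∈ J, i ≤ j
  prev_mem : ∀ j ∈ J, ∀ p ∈ prev j, p ∈ J ∧ p ≤ j ∧ rank p < rank j
  total : ∀ i ∈ J, ∀ j ∈ J, i ≠ j →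
    (∃ p ∈ prev j, i ≤ p ∧ p ≤ j) ∨ ∃ p ∈ prev i, j ≤ p ∧ p ≤ i

theorem exists_monotone_cofinal_seq {I : Type t} [PartialOrder I] [IsDirectedOrder I] [Nonempty I]
    (hI : ∃ s : Set I, s.Countable ∧ IsCofinal s) :
    ∃ c : ℕ → I, Monotone c ∧ ∀ i, ∃ n, i ≤ c n := by
  obtain ⟨s, hs, hcof⟩ := hI
  have := hs.toEncodable
  obtain ⟨i₀⟩ := ‹Nonempty I›
  have : Inhabited s := ⟨⟨_, (hcof i₀).choose_spec.1⟩⟩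
  have hd : Directed (· ≤ ·) (Subtype.val : s → I) := fun a b => by
    obtain ⟨k, ha, hb⟩ := exists_ge_ge a.1 b.1
    obtain ⟨l, hl, hkl⟩ := hcof k
    exact ⟨⟨l, hl⟩, ha.trans hkl, hb.trans hkl⟩
  refine ⟨Subtype.val ∘ hd.sequence Subtype.val, hd.sequence_mono, fun i => ?_⟩
  obtain ⟨j, hj, hij⟩ := hcof i
  exact ⟨_, hij.trans (hd.le_sequence ⟨j, hj⟩)⟩

theorem exists_cofinalChain {I : Type t} [PartialOrder I] [IsDirectedOrder I] [Nonempty I]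
    (hI : ∃ s : Set I, s.Countable ∧ IsCofinal s) : Nonempty (CofinalChain I) := by
  classical
  obtain ⟨c, hc, hcof⟩ := exists_monotone_cofinal_seq hI
  -- The rank of `i` is the first position of `i` in the sequence `c`, which may have repetitions.
  let rank : I → ℕ := fun i => if h : ∃ n, c n = i then Nat.find h else 0
  have hrank : ∀ i ∈ Set.range c, c (rank i) = i := fun i hi => by
    have hi' : ∃ n, c n = i := hi
    simp only [rank, dif_pos hi']
    exact Nat.find_spec hi'
  have hmin : ∀ n, rank (c n) ≤ n := fun n => by
    have hi' : ∃ m, c m = c n := ⟨n, rfl⟩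
    simp only [rank, dif_pos hi']
    exact Nat.find_min' hi' rfl
  let prev : I → Option I := fun i => if rank i = 0 then none else some (c (rank i - 1))
  have hprev : ∀ i p, p ∈ prev i ↔ rank i ≠ 0 ∧ c (rank i - 1) = p := fun i p => by
    simp only [prev]
    split_ifs with h <;> simp [h]
  have hlt : ∀ i ∈ Set.range c, ∀ j ∈ Set.range c, rank i < rank j →
      ∃ p ∈ prev j, i ≤ p ∧ p ≤ j := fun i hi j hj hij => by
    refine ⟨_, (hprev j _).2 ⟨by omega, rfl⟩, ?_, ?_⟩
    · conv_lhs => rw [← hrank i hi]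
      exact hc (by omega)
    · conv_rhs => rw [← hrank j hj]
      exact hc (by omega)
  refine ⟨⟨Set.range c, prev, rank, fun i => ?_, fun j hj p hp => ?_, fun i hi j hj hij => ?_⟩⟩
  · obtain ⟨n, hn⟩ := hcof i
    exact ⟨_, ⟨n, rfl⟩, hn⟩
  · obtain ⟨h0, rfl⟩ := (hprev j p).1 hp
    refine ⟨⟨_, rfl⟩, ?_, ?_⟩
    · conv_rhs => rw [← hrank j hj]
      exact hc (by omega)
    · have := hmin (rank j - 1)
      omega
  · rcases lt_trichotomy (rank i) (rank j) with h | h | h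
    · exact Or.inl (hlt i hi j hj h)
    · exact (hij (by rw [← hrank i hi, h, hrank j hj])).elim
    · exact Or.inr (hlt j hj i hi h)

namespace GradedSymbols

variable {L : MSLanguage.{u, v}} {I : Type t} [PartialOrder I] {P : GradedSymbols L I}
variable {N : Str.{u, v, w} L} {μ : ∀ i, P.Elt N i → ℝ} {Q : ProbabilityMeasure (P.Lim N)}

/-- The elements that generate the pieces of the decomposition: those of the sorts in the chain
whose class is not a copy from the preceding sort of the chain. -/
def IsNew (P : GradedSymbols L I) (C : CofinalChain I) {N : Str.{u, v, w} L} (i : I)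
    (x : P.Elt N i) : Prop :=
  i ∈ C.J ∧ ∀ p ∈ C.prev i, ¬ P.IsCopyFrom p x

namespace Pieces

variable {D : P.Pieces} {C : CofinalChain I}

theorem block_le (h : P.IsFiniteSystem N) (i : I) (a : P.Cls N i) :
    D.block Q i a ≤ clsSpan Q a := by
  refine Submodule.span_le.2 ?_
  rintro _ ⟨x, hx, -, rfl⟩
  exact h.cls_eq hx ▸ resid_mem_clsSpan h x

theorem finiteDimensional_block (h : P.IsFiniteSystem N) (i : I) (a : P.Cls N i) :
    FiniteDimensional ℝ (D.block Q i a) := by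
  have := finiteDimensional_clsSpan (Q := Q) h a
  exact Submodule.finiteDimensional_of_le (block_le h i a)

theorem iSup_block (h : P.IsFiniteSystem N) (i : I) :
    ⨆ a, D.block Q i a = Submodule.span ℝ (D.points Q i) := by
  refine le_antisymm (iSup_le fun a => Submodule.span_mono ?_) (Submodule.span_le.2 ?_)
  · rintro _ ⟨x, -, hx, rfl⟩
    exact ⟨x, hx, rfl⟩
  · rintro _ ⟨x, hx, rfl⟩
    exact Submodule.mem_iSup_of_mem (P.cls N x)
      (Submodule.subset_span ⟨x, h.mem_cls x, hx, rfl⟩)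

section TwoRegular

variable (h : P.IsTwoRegular N μ) (hQ : P.IsLimitMeasure μ Q)
include h hQ

theorem asymptoticallyFree (i : I) : IsAsymptoticallyFree (D.points Q i) := by
  rintro _ ⟨x, hx, rfl⟩ ε hε
  refine Set.Finite.isCompact
    (((h.toIsFiniteSystem.finite (P.cls N x)).image (P.resid Q)).subset ?_)
  rintro _ ⟨⟨y, hy, rfl⟩, hle⟩
  refine ⟨y, ?_, rfl⟩
  by_contra hxy
  rw [inner_resid_resid_of_ne h hQ, abs_zero] at hle
  · exact absurd hle (not_le.2 hε)
  · intro heq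
    exact hxy (heq ▸ h.toIsFiniteSystem.mem_cls y)

theorem space_sum (i : I) : IsCompletedOrthogonalSum (D.block Q i) (D.space Q i) := by
  have hf := h.toIsFiniteSystem
  refine ⟨fun a => ?_, fun a b hab => ?_, ?_⟩
  · have := finiteDimensional_block (D := D) (Q := Q) hf i a
    exact Submodule.closed_of_finiteDimensional _
  · refine Submodule.isOrtho_span.2 ?_
    rintro _ ⟨x, hx, -, rfl⟩ _ ⟨y, hy, -, rfl⟩
    refine inner_resid_resid_of_ne h hQ fun heq => hab ?_
    rw [← hf.cls_eq hx, ← hf.cls_eq hy, heq]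
  · rw [iSup_block hf]
    rfl

variable (hD : ∀ i (x : P.Elt N i), (D.dom i).Realize N (env₁ x) ↔ P.IsNew C i x)
include hD

theorem space_isOrtho {i j : I} (hij : i ≠ j) : D.space Q i ⟂ D.space Q j := by
  have hf := h.toIsFiniteSystem
  have key : ∀ {i j p}, p ∈ C.prev j → i ≤ p → p ≤ j →
      ∀ (x : P.Elt N i) (y : P.Elt N j), P.IsNew C j y →
        inner ℝ (P.resid Q x) (P.resid Q y) = 0 := by
    intro i j p hp hip hpj x y hy
    obtain ⟨b, hb, -⟩ := hf.copy hip (P.cls N x)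
    refine (Submodule.mem_orthogonal _ _).1
      (resid_mem_orthogonal_of_not_isCopyFrom h hQ hpj (hy.2 p hp) b) _ ?_
    rw [← clsSpan_eq_of_isBij hf hb]
    exact resid_mem_clsSpan hf x
  rw [Submodule.isOrtho_iff_le, space, space, Submodule.orthogonal_closure]
  refine Submodule.topologicalClosure_minimal _ ?_ (Submodule.isClosed_orthogonal _)
  rw [← Submodule.isOrtho_iff_le, Submodule.isOrtho_span]
  rintro _ ⟨x, hx, rfl⟩ _ ⟨y, hy, rfl⟩
  rw [hD] at hx hy
  rcases C.total i hx.1 j hy.1 hij with ⟨p, hp, hip, hpj⟩ | ⟨p, hp, hjp, hpi⟩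
  · exact key hp hip hpj x y hy
  · rw [real_inner_comm]
    exact key hp hjp hpi y x hx

omit hQ in
/-- Induction along the chain and, within one sort, on the size of the class. -/
theorem clsSpan_le_iSup_space_of_mem {i : I} (hi : i ∈ C.J) (a : P.Cls N i) :
    clsSpan Q a ≤ ⨆ i, D.space Q i := by
  have hf := h.toIsFiniteSystem
  induction hr : C.rank i using Nat.strong_induction_on generalizing i with
  | _ r ihr =>
  induction hn : a.1.ncard using Nat.strong_induction_on generalizing a with
  | _ n ihn =>
  refine Submodule.span_le.2 ?_
  rintro _ ⟨x, hx, rfl⟩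
  by_cases hnew : P.IsNew C i x
  · have h₁ : P.resid Q x ∈ ⨆ i, D.space Q i := Submodule.mem_iSup_of_mem i
      (Submodule.le_topologicalClosure _ (Submodule.subset_span ⟨x, (hD i x).2 hnew, rfl⟩))
    have h₂ : P.lower Q x ≤ ⨆ i, D.space Q i := lower_le_iff.2 fun b hb hne => by
      have hlt := hf.ncard_lt hb hne
      rw [hf.cls_eq hx, hn] at hlt
      exact ihn _ hlt b rfl
    have := add_mem h₁ (h₂ (vec_sub_resid_mem hf x))
    rwa [add_sub_cancel] at this
  · simp only [IsNew, hi, true_and, not_forall, not_not] at hnew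
    obtain ⟨p, hp, hpi, a', ha'⟩ := hnew
    obtain ⟨hpJ, -, hlt⟩ := C.prev_mem i hi p hp
    rw [hf.cls_eq hx] at ha'
    have hmem := vec_mem_clsSpan (Q := Q) hx
    rw [← clsSpan_eq_of_isBij hf ha'] at hmem
    exact ihr _ (hr ▸ hlt) hpJ a' rfl hmem

theorem total_sum (hne : ∃ i, Nonempty (P.Elt N i)) :
    IsCompletedOrthogonalSum (D.space Q) ⊤ := by
  have hf := h.toIsFiniteSystem
  refine ⟨fun i => Submodule.isClosed_topologicalClosure _,
    fun i j hij => space_isOrtho h hQ hD hij, ?_⟩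
  rw [eq_top_iff, ← topologicalClosure_iSup_clsSpan hf hne]
  refine Submodule.topologicalClosure_mono (iSup₂_le fun i a => ?_)
  obtain ⟨j, hj, hij⟩ := C.cofinal i
  obtain ⟨b, hb, -⟩ := hf.copy hij a
  rw [clsSpan_eq_of_isBij hf hb]
  exact clsSpan_le_iSup_space_of_mem h hD hj b

end TwoRegular

end Pieces

end GradedSymbols

/-! ### Definability of the inner products -/

/-- The inner product of a projected vector with another vector is determined by the Gram matrix of
a spanning family and by the coordinates of the vectors and of the subspace. -/
theorem inner_eq_of_gram {E H H' : Type*} [AddCommGroup E] [Module ℝ E]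
    [NormedAddCommGroup H] [InnerProductSpace ℝ H] [NormedAddCommGroup H'] [InnerProductSpace ℝ H']
    (T : E →ₗ[ℝ] H) (T' : E →ₗ[ℝ] H') (hT : ∀ u v, inner ℝ (T u) (T v) = inner ℝ (T' u) (T' v))
    (W : Submodule ℝ E) (u v : E) {r : H} {r' : H'} (hr : T u - r ∈ W.map T)
    (hr₀ : r ∈ (W.map T)ᗮ) (hr' : T' u - r' ∈ W.map T') (hr₀' : r' ∈ (W.map T')ᗮ) :
    inner ℝ r (T v) = inner ℝ r' (T' v) := by
  obtain ⟨w, hw, hwr⟩ := hr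
  have hrw : r = T (u - w) := by rw [map_sub, hwr, sub_sub_cancel]
  have hmem : r' - T' (u - w) ∈ W.map T' := by
    have := sub_mem (Submodule.mem_map_of_mem (f := T') hw) hr'
    rw [map_sub]
    convert this using 1
    abel
  have horth : r' - T' (u - w) ∈ (W.map T')ᗮ := by
    refine sub_mem hr₀' ((Submodule.mem_orthogonal _ _).2 ?_)
    rintro _ ⟨w', hw', rfl⟩
    rw [← hT, ← hrw]
    exact (Submodule.mem_orthogonal _ _).1 hr₀ _ (Submodule.mem_map_of_mem hw')
  have hr'w : r' = T' (u - w) :=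
    sub_eq_zero.1 (inner_self_eq_zero.1 ((Submodule.mem_orthogonal _ _).1 horth _ hmem))
  rw [hrw, hr'w, hT]

namespace MSLanguage

variable {L : MSLanguage.{u, v}} {𝒦 : Type*} {str : 𝒦 → Str.{u, v, w} L} {Γ : List L.Srt}

theorem FinDef.subst₂ {s s' : L.Srt} {T : Type*}
    {F : ∀ k, (str k).carrier s → (str k).carrier s' → T}
    (h : FinDef str [s, s'] fun k e => F k (e s .zero) (e s' (.succ .zero)))
    (p : Var Γ s) (q : Var Γ s') : FinDef str Γ fun k e => F k (e s p) (e s' q) :=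
  h.rename fun s'' r => Env.cons (A := Var Γ) p (Env.cons q Env.nil) s'' r

/-- A function that is given by a finitely definable function of auxiliary elements, which exist
and satisfy a definable condition, is finitely definable. -/
theorem FinDef.of_exists_tuple {s : L.Srt} (n : ℕ) {T : Type*} [Nonempty T]
    {R : ∀ k, (Fin n → (str k).carrier s) → Env (str k).carrier Γ → Prop}
    {F : ∀ k, (Fin n → (str k).carrier s) → Env (str k).carrier Γ → T}
    {G : ∀ k, Env (str k).carrier Γ → T}
    (hR : Dfn str (tupleCtx s n Γ) fun k e =>
      R k (fun i => e s (tupleVar s Γ n i)) fun s' p => e s' (tupleWk s Γ n s' p))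
    (hF : FinDef str (tupleCtx s n Γ) fun k e =>
      F k (fun i => e s (tupleVar s Γ n i)) fun s' p => e s' (tupleWk s Γ n s' p))
    (hex : ∀ k e, ∃ x, R k x e) (hG : ∀ k x e, R k x e → F k x e = G k e) : FinDef str Γ G := by
  refine (FinDef.image_tuple n hR hF).factor fun k e k' e' heq => ?_
  obtain ⟨x, hx⟩ := hex k e
  have hmem : F k x e ∈ {d | ∃ x, R k x e ∧ F k x e = d} := ⟨x, hx, rfl⟩
  rw [heq] at hmem
  obtain ⟨x', hx', hxx'⟩ := hmem
  rw [← hG k x e hx, ← hxx', hG k' x' e' hx']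

end MSLanguage

namespace GradedSymbols

variable {L : MSLanguage.{u, v}} {I : Type t} [PartialOrder I] {P : GradedSymbols L I}

section Enumeration

variable {N : Str.{u, v, w} L} {μ : ∀ i, P.Elt N i → ℝ} {Q : ProbabilityMeasure (P.Lim N)}

/-- The linear map that sends the basis vectors to the vectors of the elements of a tuple. -/
noncomputable def tupleMap (Q : ProbabilityMeasure (P.Lim N)) {i : I} {n : ℕ}
    (x : Fin n → P.Elt N i) : (Fin n → ℝ) →ₗ[ℝ] P.L2 Q :=
  Fintype.linearCombination ℝ fun p => P.vec Q (x p)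

open Classical in
/-- The characteristic function of a set of indices. -/
noncomputable def charVec {n : ℕ} (A : Fin n → Prop) : Fin n → ℝ := fun p => if A p then 1 else 0

theorem tupleMap_charVec (h : P.IsFiniteSystem N) {i j : I} {hij : i ≤ j} {a : P.Cls N i}
    {b : P.Cls N j} (hab : P.ClsLe hij a b) {n : ℕ} {x : Fin n → P.Elt N j}
    (hx : Enumerates x b.1) {z : P.Elt N i} (hz : z ∈ a.1) :
    tupleMap Q x (charVec fun p => P.Le N hij z (x p)) = P.vec Q z := by
  classical
  have hb : (h.finite b).toFinset = Finset.univ.map ⟨x, hx.1⟩ := by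
    ext y
    simp [hx.2]
  rw [vec_eq_sum h hab hz, hb, Finset.sum_filter, Finset.sum_map, tupleMap,
    Fintype.linearCombination_apply]
  refine Finset.sum_congr rfl fun p _ => ?_
  by_cases hp : P.Le N hij z (x p) <;> simp [charVec, hp]

theorem inner_tupleMap (h : P.IsFiniteSystem N) (hQ : P.IsLimitMeasure μ Q) {i : I} {b : P.Cls N i}
    {n : ℕ} {x : Fin n → P.Elt N i} (hx : Enumerates x b.1) (c d : Fin n → ℝ) :
    inner ℝ (tupleMap Q x c) (tupleMap Q x d) = ∑ p, c p * d p * μ i (x p) := by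
  have hmem : ∀ p, x p ∈ b.1 := fun p => (hx.2 _).2 ⟨p, rfl⟩
  simp only [tupleMap, Fintype.linearCombination_apply, sum_inner, inner_sum]
  refine Finset.sum_congr rfl fun p _ => ?_
  rw [Finset.sum_eq_single_of_mem p (Finset.mem_univ p)]
  · rw [inner_smul_left, inner_smul_right, inner_vec_self hQ]
    simp [mul_assoc]
  · intro q _ hne
    rw [inner_smul_left, inner_smul_right, inner_vec_of_ne h (hmem q) (hmem p) (hx.1.ne hne)]
    simp

/-- The sets of indices of those elements of a tuple that lie above an element of a class strictly
below `[x]`. -/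
def lowerPatterns {i : I} {n : ℕ} (t : Fin n → P.Elt N i) (x : P.Elt N i) (A : Fin n → Prop) :
    Prop :=
  ∃ z : P.Elt N i, (P.ClsLe le_rfl (P.cls N z) (P.cls N x) ∧ ¬ P.cls N z = P.cls N x) ∧
    ∀ p, P.Le N le_rfl z (t p) ↔ A p

theorem map_lowerPatterns (h : P.IsFiniteSystem N) {i : I} {x y : P.Elt N i}
    (hxy : P.ClsLe le_rfl (P.cls N x) (P.cls N y)) {n : ℕ} {t : Fin n → P.Elt N i}
    (ht : Enumerates t (P.cls N y).1) :
    (Submodule.span ℝ (charVec '' {A | lowerPatterns t x A})).map (tupleMap Q t) =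
      P.lower Q x := by
  rw [Submodule.map_span, lower]
  congr 1
  ext ξ
  constructor
  · rintro ⟨_, ⟨A, ⟨z, ⟨hzx, hne⟩, hA⟩, rfl⟩, rfl⟩
    refine ⟨P.cls N z, hzx, hne, z, h.mem_cls z, ?_⟩
    obtain rfl : (fun p => P.Le N le_rfl z (t p)) = A := funext fun p => propext (hA p)
    exact tupleMap_charVec h (h.clsLe_trans hzx hxy) ht (h.mem_cls z)
  · rintro ⟨b, hb, hne, z, hz, rfl⟩
    obtain rfl := h.cls_eq hz
    exact ⟨_, ⟨_, ⟨z, ⟨hb, hne⟩, fun p => Iff.rfl⟩, rfl⟩,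
      tupleMap_charVec h (h.clsLe_trans hb hxy) ht (h.mem_cls z)⟩

end Enumeration

/-- A structure in which the functions `m i` define a `2`-regular system with classes of size at
most `K i`, with the measure on its inverse limit. -/
structure Model (P : GradedSymbols L I) (m : ∀ i, StrictReal L [P.S i]) (K : I → ℕ) extends
    Bounded.{u, v, w, t} P m K where
  regular : P.IsTwoRegular str fun i => (m i).value str
  Q : ProbabilityMeasure (P.Lim str)
  isLimit : P.IsLimitMeasure (fun i => (m i).value str) Q

namespace Model

variable {m : ∀ i, StrictReal L [P.S i]} {K : I → ℕ}

/-- The underlying structure of a model. -/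
abbrev toStr (k : Model.{u, v, w, t} P m K) : Str.{u, v, w} L := k.str

theorem finite (k : Model.{u, v, w, t} P m K) : P.IsFiniteSystem k.toStr :=
  k.regular.toIsFiniteSystem

variable (m K) in
/-- For `x` and `y` in one sort, `⟨P_{W[x]^⊥} x, y⟩` vanishes unless `[x] ≤ [y]`; then it is
computed in the span of `[y]`. -/
theorem finDef_inner_vec (i : I) :
    FinDef (toStr.{u, v, w, t} (P := P) (m := m) (K := K)) [P.S i, P.S i] fun k e =>
      (inner ℝ (P.resid k.Q (e _ .zero)) (P.vec k.Q (e _ (.succ .zero))) : ℝ) := by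
  let F : ∀ n (k : Model.{u, v, w, t} P m K), (Fin n → k.toStr.carrier (P.S i)) →
      Env k.toStr.carrier [P.S i, P.S i] →
      Prop × (Fin n → ℝ) × (Fin n → Prop) × (Fin n → Prop) × ((Fin n → Prop) → Prop) :=
    fun n k t e => (P.ClsLe le_rfl (P.cls k.toStr (e _ .zero)) (P.cls k.toStr (e _ (.succ .zero))),
      fun p => (m i).value k.toStr (t p), fun p => P.Le k.toStr le_rfl (e _ .zero) (t p),
      fun p => P.Le k.toStr le_rfl (e _ (.succ .zero)) (t p), lowerPatterns t (e _ .zero))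
  refine FinDef.of_enum (str := toStr) (T' := ℝ) (B := K i) (F := F)
    (R := fun k w e => w ∈ (P.cls k.toStr (e _ (.succ .zero))).1) (dfn_mem _ _)
    (fun k e => k.encard_le i (P.cls k.toStr (e _ (.succ .zero)))) (fun n => ?_) ?_
  · refine .prod (.of_dfn (dfn_clsLe _ _ _)) (.prod
      (.pi fun p => .value (fun k => k.isFunctional i) _)
      (.prod (.pi fun p => .of_dfn (dfn_le _ _ _)) (.prod (.pi fun p => .of_dfn (dfn_le _ _ _))
        (.pi fun A => .of_dfn ?_))))
    exact .ex (.and (.and (dfn_clsLe _ _ _) (.not (dfn_cls_eq _ _)))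
      (.all_finite fun p => .iff (dfn_le _ _ _) (.const _)))
  · intro n k e t k' e' t' ht ht' heq
    simp only [F, Prod.mk.injEq] at heq
    obtain ⟨hle, hμ, hx, hy, hF⟩ := heq
    by_cases hxy : P.ClsLe le_rfl (P.cls k.toStr (e _ .zero)) (P.cls k.toStr (e _ (.succ .zero)))
    · have hxy' := hle ▸ hxy
      have hvy := tupleMap_charVec (Q := k.Q) k.finite (k.finite.clsLe_refl _) ht
        (k.finite.mem_cls (e _ (.succ .zero)))
      have hvy' := tupleMap_charVec (Q := k'.Q) k'.finite (k'.finite.clsLe_refl _) ht'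
        (k'.finite.mem_cls (e' _ (.succ .zero)))
      have hvx := tupleMap_charVec (Q := k.Q) k.finite hxy ht (k.finite.mem_cls (e _ .zero))
      have hvx' := tupleMap_charVec (Q := k'.Q) k'.finite hxy' ht' (k'.finite.mem_cls (e' _ .zero))
      have hW := map_lowerPatterns (Q := k.Q) k.finite hxy ht
      have hW' := map_lowerPatterns (Q := k'.Q) k'.finite hxy' ht'
      rw [← hx] at hvx'
      rw [← hy] at hvy'
      rw [← hF] at hW'
      rw [← hvy, ← hvy']
      refine inner_eq_of_gram (tupleMap k.Q t) (tupleMap k'.Q t') (fun c d => ?_)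
        (Submodule.span ℝ (charVec '' {A | lowerPatterns t (e _ .zero) A}))
        (charVec fun p => P.Le k.toStr le_rfl (e _ .zero) (t p)) _
        (hr := ?_) (hr₀ := ?_) (hr' := ?_) (hr₀' := ?_)
      · rw [inner_tupleMap (b := P.cls k.toStr (e _ (.succ .zero))) k.finite k.isLimit ht,
          inner_tupleMap (b := P.cls k'.toStr (e' _ (.succ .zero))) k'.finite k'.isLimit ht']
        exact Finset.sum_congr rfl fun p _ => by rw [congrFun hμ p]
      · rw [hvx, hW]
        exact vec_sub_resid_mem k.finite _
      · rw [hW]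
        exact resid_mem_orthogonal _
      · rw [hvx', hW']
        exact vec_sub_resid_mem k'.finite _
      · rw [hW']
        exact resid_mem_orthogonal _
    · rw [(Submodule.mem_orthogonal' _ _).1
          (resid_mem_orthogonal_clsSpan k.regular k.isLimit hxy) _
          (vec_mem_clsSpan (k.finite.mem_cls _)),
        (Submodule.mem_orthogonal' _ _).1
          (resid_mem_orthogonal_clsSpan k'.regular k'.isLimit (hle ▸ hxy)) _
          (vec_mem_clsSpan (k'.finite.mem_cls _))]

variable (m K) in
open Classical in
theorem finDef_inner_resid (i : I) :
    FinDef (toStr.{u, v, w, t} (P := P) (m := m) (K := K)) [P.S i, P.S i] fun k e =>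
      (inner ℝ (P.resid k.Q (e _ .zero)) (P.resid k.Q (e _ (.succ .zero))) : ℝ) := by
  refine (((FinDef.of_dfn (dfn_cls_eq .zero (.succ .zero))).prod
    (finDef_inner_vec m K i)).comp fun r => if r.1 then r.2 else 0).congr fun k e => ?_
  simp only
  split_ifs with heq
  · exact (inner_resid_resid_of_eq k.regular heq).symm
  · exact (inner_resid_resid_of_ne k.regular k.isLimit heq).symm

/-- `x'` is the copy of `x`. -/
def IsEltCopy (N : Str.{u, v, w} L) {i j : I} (hij : i ≤ j) (x : P.Elt N i) (x' : P.Elt N j) :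
    Prop :=
  P.IsBij hij (P.cls N x) (P.cls N x') ∧ P.Le N hij x x'

theorem exists_isEltCopy {N : Str.{u, v, w} L} (h : P.IsFiniteSystem N) {i j : I} (hij : i ≤ j)
    (x : P.Elt N i) : ∃ x' : P.Elt N j, IsEltCopy N hij x x' := by
  obtain ⟨b, hb, -⟩ := h.copy hij (P.cls N x)
  obtain ⟨x', ⟨hx', hle⟩, -⟩ := hb.1 x (h.mem_cls x)
  obtain rfl := h.cls_eq hx'
  exact ⟨x', hb, hle⟩

/-- Functions of two elements of arbitrary sorts that do not change when the elements are replaced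
by their copies in a common larger sort. -/
theorem finDef_of_copies {i j l : I} (hi : i ≤ l) (hj : j ≤ l)
    {F : ∀ k : Model.{u, v, w, t} P m K, P.Elt k.toStr l → P.Elt k.toStr l → ℝ}
    {G : ∀ k : Model.{u, v, w, t} P m K, P.Elt k.toStr i → P.Elt k.toStr j → ℝ}
    (hF : FinDef (toStr.{u, v, w, t} (P := P) (m := m) (K := K)) [P.S l, P.S l] fun k e =>
      F k (e _ .zero) (e _ (.succ .zero)))
    (hG : ∀ k x y x' y', IsEltCopy k.toStr hi x x' → IsEltCopy k.toStr hj y y' →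
      F k x' y' = G k x y) :
    FinDef (toStr.{u, v, w, t} (P := P) (m := m) (K := K)) [P.S i, P.S j] fun k e =>
      G k (e _ .zero) (e _ (.succ .zero)) := by
  refine FinDef.of_exists_tuple (s := P.S l) 2
    (R := fun k t e => IsEltCopy k.toStr hi (e (P.S i) .zero) (t 0) ∧
      IsEltCopy k.toStr hj (e (P.S j) (.succ .zero)) (t 1))
    (F := fun k t _ => F k (t 0) (t 1)) ?_ (hF.subst₂ _ _) (fun k e => ?_)
    fun k t e ht => hG k _ _ _ _ ht.1 ht.2
  · exact .and (.and (dfn_isBij _ _ _) (dfn_le _ _ _)) (.and (dfn_isBij _ _ _) (dfn_le _ _ _))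
  · obtain ⟨x', hx'⟩ := exists_isEltCopy k.finite hi (e _ .zero)
    obtain ⟨y', hy'⟩ := exists_isEltCopy k.finite hj (e _ (.succ .zero))
    exact ⟨![x', y'], hx', hy'⟩

theorem IsEltCopy.vec_eq {N : Str.{u, v, w} L} (h : P.IsFiniteSystem N)
    {Q : ProbabilityMeasure (P.Lim N)} {i j : I} {hij : i ≤ j} {x : P.Elt N i} {x' : P.Elt N j}
    (hx : IsEltCopy N hij x x') : P.vec Q x = P.vec Q x' :=
  vec_eq_of_isBij h hx.1 (h.mem_cls x) (h.mem_cls x') hx.2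

variable [IsDirectedOrder I]

variable (P m K) in
theorem exists_innSelf (i j : I) : ∃ d : StrictReal L [P.S i, P.S j],
    ∀ k : Model.{u, v, w, t} P m K, d.Defines₂ k.toStr fun x y =>
      inner ℝ (P.resid k.Q x) (P.resid k.Q y) := by
  obtain ⟨l, hi, hj⟩ := exists_ge_ge i j
  refine FinDef.exists_strictReal (str := toStr) (F := fun (k : Model.{u, v, w, t} P m K) x y =>
    inner ℝ (P.resid k.Q x) (P.resid k.Q y)) (finDef_of_copies hi hj
      (F := fun k x y => inner ℝ (P.resid k.Q x) (P.resid k.Q y))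
      (G := fun k x y => inner ℝ (P.resid k.Q x) (P.resid k.Q y)) (finDef_inner_resid m K l) ?_)
  intro k x y x' y' hx hy
  rw [resid_eq_of_isBij k.regular k.isLimit hx.1 hx.2,
    resid_eq_of_isBij k.regular k.isLimit hy.1 hy.2]

variable (P m K) in
theorem exists_innSort (i j : I) : ∃ d : StrictReal L [P.S i, P.S j],
    ∀ k : Model.{u, v, w, t} P m K, d.Defines₂ k.toStr fun x y =>
      inner ℝ (P.resid k.Q x) (P.vec k.Q y) := by
  obtain ⟨l, hi, hj⟩ := exists_ge_ge i j
  refine FinDef.exists_strictReal (str := toStr) (F := fun (k : Model.{u, v, w, t} P m K) x y =>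
    inner ℝ (P.resid k.Q x) (P.vec k.Q y)) (finDef_of_copies hi hj
      (F := fun k x y => inner ℝ (P.resid k.Q x) (P.vec k.Q y))
      (G := fun k x y => inner ℝ (P.resid k.Q x) (P.vec k.Q y)) (finDef_inner_vec m K l) ?_)
  intro k x y x' y' hx hy
  rw [resid_eq_of_isBij k.regular k.isLimit hx.1 hx.2, hy.vec_eq k.finite]

omit [IsDirectedOrder I] in
variable (P m K) in
theorem exists_eqv (i : I) : ∃ φ : Formula L [P.S i, P.S i],
    ∀ (k : Model.{u, v, w, t} P m K) (x y : P.Elt k.toStr i),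
      φ.Realize k.toStr (env₂ x y) ↔ P.resid k.Q x = P.resid k.Q y := by
  have hF := fun p q : Var [P.S i, P.S i] (P.S i) => FinDef.subst₂ (Γ := [P.S i, P.S i])
    (F := fun (k : Model.{u, v, w, t} P m K) x y => (inner ℝ (P.resid k.Q x) (P.resid k.Q y) : ℝ))
    (finDef_inner_resid m K i) p q
  obtain ⟨φ, hφ⟩ := ((hF .zero .zero).prod ((hF .zero (.succ .zero)).prod
    (hF (.succ .zero) (.succ .zero)))).dfn_comp fun r => r.1 - 2 * r.2.1 + r.2.2 = 0
  refine ⟨φ, fun k x y => (hφ k (env₂ x y)).trans ?_⟩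
  rw [← sub_eq_zero, ← inner_self_eq_zero (𝕜 := ℝ), real_inner_sub_sub_self]
  exact Iff.rfl

omit [IsDirectedOrder I] in
variable (P m K) in
theorem exists_dom (C : CofinalChain I) (i : I) : ∃ φ : Formula L [P.S i],
    ∀ (k : Model.{u, v, w, t} P m K) (x : P.Elt k.toStr i),
      φ.Realize k.toStr (env₁ x) ↔ P.IsNew C i x := by
  have hcopy : ∀ p, Dfn (toStr.{u, v, w, t} (P := P) (m := m) (K := K)) [P.S i] fun k e =>
      P.IsCopyFrom p (e (P.S i) .zero) := fun p => by
    by_cases hp : p ≤ i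
    · refine (dfn_ex_cls (R := fun k a e => P.IsBij hp a (P.cls k.toStr (e (P.S i) .zero)))
        (dfn_isBij _ _ _)).congr fun k e => ?_
      simp [IsCopyFrom, hp]
    · exact (Dfn.const False).congr fun k e => by simp [IsCopyFrom, hp]
  have hnew : Dfn (toStr.{u, v, w, t} (P := P) (m := m) (K := K)) [P.S i] fun k e =>
      P.IsNew C i (e (P.S i) .zero) := by
    refine .and (.const _) ?_
    rcases C.prev i with _ | p
    · exact (Dfn.const True).congr fun k e => by simp
    · exact (hcopy p).not.congr fun k e => by simp
  obtain ⟨φ, hφ⟩ := hnew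
  exact ⟨φ, fun k x => hφ k (env₁ x)⟩

end Model

end GradedSymbols

theorem mainTheorem8 {L : MSLanguage.{u, v}} {I : Type t} [PartialOrder I] [IsDirectedOrder I]
    (hI : ∃ s : Set I, s.Countable ∧ IsCofinal s)
    (P : GradedSymbols L I) (M : MSLanguage.Str.{u, v, w} L)
    (hM : ∃ i, Nonempty (P.Elt M i))
    (m : ∀ i, MSLanguage.StrictReal L [P.S i]) (μ : ∀ i, P.Elt M i → ℝ)
    (hμ : ∀ i, (m i).Defines₁ M (μ i)) (hreg : P.IsTwoRegular M μ) :
    ∃ D : P.Pieces, ∀ N : MSLanguage.Str.{u, v, w} L, MSLanguage.ElemEquiv M N →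
      ∃ ν : ∀ i, P.Elt N i → ℝ, (∀ i, (m i).Defines₁ N (ν i)) ∧ P.IsTwoRegular N ν ∧
        ∃ Q : ProbabilityMeasure (P.Lim N), P.IsLimitMeasure ν Q ∧
          (∀ Q' : ProbabilityMeasure (P.Lim N), P.IsLimitMeasure ν Q' → Q' = Q) ∧
          D.Decompose Q := by
  obtain ⟨i₀, hi₀⟩ := hM
  have : Nonempty I := ⟨i₀⟩
  obtain ⟨C⟩ := exists_cofinalChain hI
  choose K _ hK using hreg.bounded
  choose eqv heqv using GradedSymbols.Model.exists_eqv.{u, v, w, t} P m K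
  choose dom hdom using GradedSymbols.Model.exists_dom.{u, v, w, t} P m K C
  choose innSelf hself using GradedSymbols.Model.exists_innSelf.{u, v, w, t} P m K
  choose innSort hsort using GradedSymbols.Model.exists_innSort.{u, v, w, t} P m K
  refine ⟨⟨eqv, dom, innSelf, innSort⟩, fun N hMN => ?_⟩
  obtain ⟨hfun, hregN⟩ := hreg.transfer hMN m hμ
  have hne : ∃ i, Nonempty (P.Elt N i) := ⟨i₀, by
    obtain ⟨x, -⟩ := Dfn.transfer (str := id) (R := fun N => ∃ _ : P.Elt N i₀, True)
      (.ex (.const _)) hMN ⟨hi₀.some, trivial⟩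
    exact ⟨x⟩⟩
  obtain ⟨Q, hQ⟩ := GradedSymbols.exists_isLimitMeasure hregN.toIsProbabilitySystem hne
  refine ⟨_, fun i => (hfun i).defines, hregN, Q, hQ, fun Q' hQ' =>
    GradedSymbols.isLimitMeasure_unique hregN.toIsFiniteSystem hne hQ hQ', ?_⟩
  let k : P.Model m K := ⟨⟨N, hfun, fun i => Dfn.transfer (str := id)
    (GradedSymbols.dfn_cls_encard_le i (K i)) hMN (hK i)⟩, hregN, Q, hQ⟩
  exact
    { eqv_iff := fun i => heqv i k
      strict_self := fun i j => hself i j k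
      strict_sort := fun i j => hsort i j k
      asymptotically_free := GradedSymbols.Pieces.asymptoticallyFree hregN hQ
      finite_dimensional := GradedSymbols.Pieces.finiteDimensional_block hregN.toIsFiniteSystem
      space_sum := GradedSymbols.Pieces.space_sum hregN hQ
      total_sum := GradedSymbols.Pieces.total_sum (C := C) hregN hQ (fun i => hdom i k) hne }
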